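/- For positive integers $l_1\ge 2$ and $l_2,\dots,l_n\ge 1$ let $$\zeta(l_1,\dots,l_n)=\sum_{m_1>m_2>\cdots>m_n>0}\frac{1}{m_1^{l_1}m_2^{l_2}\cdots m_n^{l_n}}$$ denote the multiple zeta value (a convergent series over positive integers $m_1,\dots,m_n$); for $n=1$ it is the usual zeta value $\zeta(l_1)$. Let $l$ be an integer with $l\ge 5$. Then the following two identities hold, where all summation indices are integers and an empty sum is $0$. (i) $$\frac{(l+1)(l^2-l+6)}{48}\,\zeta(l)=\sum_{\substack{l_1\ge 2,\;l_2,l_3,l_4\ge 1\\ l_1+l_2+l_3+l_4=l}}2^{l_1-1}\zeta(l_1,l_2,l_3,l_4)+\frac12\sum_{\substack{l_1\ge 2,\;l_2,l_3\ge 1\\ l_1+l_2+l_3=l}}(l-l_1-2)\,2^{l_1-1}\zeta(l_1,l_2,l_3)+\frac18\sum_{\substack{l_1\ge 2,\;l_2\ge 1\\ l_1+l_2=l}}(l-l_1-1)(l-l_1-2)\,2^{l_1-1}\zeta(l_1,l_2).$$ (ii) $$\frac{(l+1)(l^2-7l+18)}{24}\,\zeta(l)=\sum_{\substack{l_1\ge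 2,\;l_2,l_3,l_4\ge 1\\ l_1+l_2+l_3+l_4=l}}2^{l_1-1}\zeta(l_1,l_2,l_3,l_4)+\frac14\sum_{\substack{j_1,j_2\ge 3\\ j_1+j_2=l}}(j_1-1)(j_2-1)\,\zeta(j_1)\zeta(j_2).$$ -/

import Mathlib

/-- The strictly decreasing `n`-tuples `m₁ > m₂ > ⋯ > mₙ > 0` of positive integers
(`m₁` is the entry at position `0`). -/
abbrev DecreasingTuple (n : ℕ) : Type :=
  {m : Fin n → ℕ // StrictAnti m ∧ ∀ i, 0 < m i}

/-- The multiple zeta value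
`ζ(l₁, …, lₙ) = ∑_{m₁ > ⋯ > mₙ > 0} 1 / (m₁ ^ l₁ ⋯ mₙ ^ lₙ)`; the family is summable for every
admissible multi-index, see `summable_multipleZeta`. The case `n = 1` is the usual zeta value. -/
noncomputable def multipleZeta {n : ℕ} (l : Fin n → ℕ) : ℝ :=
  ∑' m : DecreasingTuple n, 1 / ∏ i, (m.1 i : ℝ) ^ l i

/-- The multi-indices `(l₁, …, lₙ)` of weight `l` with `l₁ ≥ 2` and `l₂, …, lₙ ≥ 1`. -/
def admissibleIndices (n : ℕ) [NeZero n] (l : ℕ) : Finset (Fin n → ℕ) :=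
  (Finset.Nat.antidiagonalTuple n l).filter fun k => 2 ≤ k 0 ∧ ∀ i, 1 ≤ k i

theorem mem_admissibleIndices {n : ℕ} [NeZero n] {l : ℕ} {k : Fin n → ℕ} :
    k ∈ admissibleIndices n l ↔ ∑ i, k i = l ∧ 2 ≤ k 0 ∧ ∀ i, 1 ≤ k i := by
  simp [admissibleIndices, Finset.Nat.mem_antidiagonalTuple]

theorem summable_prod_tuple {f : ℕ → ℝ} (hf : Summable f) (h0 : ∀ a, 0 ≤ f a) (n : ℕ) :
    Summable fun m : Fin n → ℕ => ∏ i, f (m i) := by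
  induction n with
  | zero => exact Summable.of_finite
  | succ n ih =>
    have h := hf.mul_of_nonneg ih h0 (fun m => Finset.prod_nonneg fun i _ => h0 (m i))
    rw [← (Fin.consEquiv fun _ : Fin (n + 1) => ℕ).summable_iff]
    refine h.congr fun x => ?_
    simp [Fin.prod_univ_succ, Fin.consEquiv]

/-- The series defining a multiple zeta value converges for `l₁ ≥ 2`, `l₂, …, lₙ ≥ 1`. -/
theorem summable_multipleZeta {n : ℕ} [NeZero n] (l : Fin n → ℕ) (h2 : 2 ≤ l 0)
    (h1 : ∀ i, 1 ≤ l i) :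
    Summable fun m : DecreasingTuple n => 1 / ∏ i, (m.1 i : ℝ) ^ l i := by
  have hn : (0 : ℝ) < n := by exact_mod_cast Nat.pos_of_ne_zero (NeZero.ne n)
  have hp : (1 : ℝ) < 1 + 1 / n := by
    have : (0 : ℝ) < 1 / n := by positivity
    linarith
  have hs := summable_prod_tuple (Real.summable_one_div_nat_rpow.2 hp)
    (fun a => by positivity) n
  refine Summable.of_nonneg_of_le (fun m => by positivity) (fun m => ?_)
    (hs.comp_injective (Subtype.val_injective (p := fun m : Fin n → ℕ =>
      StrictAnti m ∧ ∀ i, 0 < m i)))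
  obtain ⟨m, hm, hpos⟩ := m
  have hge : ∀ i, (1 : ℝ) ≤ m i := fun i => by exact_mod_cast hpos i
  have hmpos : ∀ i, (0 : ℝ) < m i := fun i => by exact_mod_cast hpos i
  simp only [Function.comp, Finset.prod_div_distrib, Finset.prod_const_one]
  refine one_div_le_one_div_of_le (Finset.prod_pos fun i _ =>
    Real.rpow_pos_of_pos (hmpos i) _) ?_
  calc ∏ i, (m i : ℝ) ^ (1 + 1 / (n : ℝ))
      = (∏ i, (m i : ℝ)) * ∏ i, (m i : ℝ) ^ (1 / (n : ℝ)) := by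
        rw [← Finset.prod_mul_distrib]
        refine Finset.prod_congr rfl fun i _ => ?_
        rw [Real.rpow_add (hmpos i), Real.rpow_one]
    _ ≤ (∏ i, (m i : ℝ)) * ∏ _i : Fin n, (m 0 : ℝ) ^ (1 / (n : ℝ)) := by
        refine mul_le_mul_of_nonneg_left (Finset.prod_le_prod (fun i _ => by positivity)
          fun i _ => ?_) (by positivity)
        refine Real.rpow_le_rpow (hmpos i).le ?_ (by positivity)
        exact_mod_cast hm.antitone (Fin.zero_le i)
    _ = (∏ i, (m i : ℝ)) * m 0 := by
        rw [Finset.prod_const, Finset.card_univ, Fintype.card_fin, ← Real.rpow_natCast,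
          ← Real.rpow_mul (hmpos 0).le, one_div_mul_cancel hn.ne', Real.rpow_one]
    _ = ∏ i, (m i : ℝ) * (if i = 0 then (m i : ℝ) else 1) := by
        rw [Finset.prod_mul_distrib, Fintype.prod_ite_eq']
    _ ≤ ∏ i, (m i : ℝ) ^ l i := by
        refine Finset.prod_le_prod (fun i _ => by split_ifs <;> positivity) fun i _ => ?_
        split_ifs with h
        · subst h
          rw [← sq]
          exact pow_le_pow_right₀ (hge _) h2
        · rw [mul_one]
          exact le_self_pow₀ (hge i) (by have := h1 i; omega)

/-- In depth one the multiple zeta value is the value of the Riemann zeta function. -/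
theorem multipleZeta_one_eq_riemannZeta {l : ℕ} (hl : 2 ≤ l) :
    (multipleZeta ![l] : ℂ) = riemannZeta l := by
  have key : multipleZeta ![l] = ∑' a : ℕ, 1 / (a : ℝ) ^ l := by
    let e : DecreasingTuple 1 → ℕ := fun m => m.1 0
    have he : Function.Injective e := fun a b h => by
      apply Subtype.ext
      funext i
      rw [Subsingleton.elim i 0]
      exact h
    have hsupp : Function.support (fun a : ℕ => 1 / (a : ℝ) ^ l) ⊆ Set.range e := by
      intro a ha
      have ha0 : 0 < a := by
        rcases Nat.eq_zero_or_pos a with rfl | h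
        · exact absurd (by simp [show l ≠ 0 by omega]) ha
        · exact h
      exact ⟨⟨fun _ => a, Subsingleton.strictAnti _, fun _ => ha0⟩, rfl⟩
    rw [← he.tsum_eq hsupp]
    simp [multipleZeta, e]
  rw [key, zeta_nat_eq_tsum_of_gt_one (by omega)]
  push_cast
  rfl

open PowerSeries Finset Filter Topology

/-! Fix the depth, truncate to `m₁ < M`, and collect all weights in one power series. The elementary
symmetric function `E_n(M)` of the series `1 / (k - X)`, `0 < k < M`, generates the truncated
multiple zeta values of depth `n`. The sum of `(1 / (m - 2X) - 1 / m) * E_3(m)` over `m < M`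
generates the sums weighted by `2 ^ (l₁ - 1)`, the subtraction removing `l₁ = 1`. Replacing `E_3` by
derivatives of `E_2` and `E_1` produces the factors polynomial in `l - l₁`.

For `p + q = m` one has `m - 2X = (p - X) + (q - X)`. Partial fractions therefore write `E_3(m) / (m
- 2X)` as the sum of an explicit kernel over the antidiagonal `p + q = m` (`sum_shuffleKernelThree`,
and its analogues for the derivatives). Summing over `m < M` gives a triangle, which equals the
square `p, q < M` minus the corner `p + q ≥ M`. Over the square the kernel factors into products of
symmetric functions, and with `P_r` the power sums, Newton's identities give `E_1 E_3 - E_2² / 2 =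
E_4 + (P_4 - P_2²) / 4`.

In (i) the weights `1, 1/2, 1/8` turn the square into `E_4 + E_3'/2 + E_2''/8 + E_1'''/48` and make
the corner vanish in the limit (`tendsto_coeff_sum_cornerKernelTotal`). In (ii) the corner
contributes `-ζ(2) P_2 / 2`; this completes `-P_2² / 4` to `-(P_2 - ζ(2))² / 4` up to a constant, so
only `j₁, j₂ ≥ 3` survive.

What remains is the sum formula: values of fixed weight and depth with `l₁ ≥ 2` add up to the zeta
value of that weight (`tendsto_coeff_esymmInv_sub`). It is proved by a connected sum, with explicit
truncation errors. -/

/-! ### Generating series and Newton's identities -/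

/-- The expansion of `1 / (k - X)`; it is `0` for `k = 0`. -/
noncomputable def invSubX (k : ℕ) : ℝ⟦X⟧ := PowerSeries.mk fun n => 1 / (k : ℝ) ^ (n + 1)

/-- The expansion of `1 / (k - 2 X)`; it is `0` for `k = 0`. -/
noncomputable def invSubTwoX (k : ℕ) : ℝ⟦X⟧ :=
  PowerSeries.mk fun n => 2 ^ n / (k : ℝ) ^ (n + 1)

/-- The elementary symmetric function of degree `n` of the series `1 / (k - X)`, `0 < k < m`. -/
noncomputable def esymmInv : ℕ → ℕ → ℝ⟦X⟧
  | 0, _ => 1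
  | n + 1, m => ∑ k ∈ range m, invSubX k * esymmInv n k

/-- The power sum of degree `r` of the series `1 / (k - X)`, `0 < k < m`. -/
noncomputable def psumInv (r m : ℕ) : ℝ⟦X⟧ := ∑ k ∈ range m, invSubX k ^ r

theorem invSubX_zero : invSubX 0 = 0 := by
  ext n; simp [invSubX]

theorem coeff_invSubX (n k : ℕ) : coeff n (invSubX k) = 1 / (k : ℝ) ^ (n + 1) := by
  simp [invSubX]

theorem coeff_invSubTwoX (n k : ℕ) : coeff n (invSubTwoX k) = 2 ^ n / (k : ℝ) ^ (n + 1) := by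
  simp [invSubTwoX]

theorem sub_X_mul_invSubX {k : ℕ} (hk : k ≠ 0) : ((k : ℝ⟦X⟧) - X) * invSubX k = 1 := by
  have hk' : (k : ℝ) ≠ 0 := by exact_mod_cast hk
  have hC : (k : ℝ⟦X⟧) = C (k : ℝ) := by simp
  ext n
  rw [hC, sub_mul, map_sub, coeff_C_mul]
  cases n with
  | zero => simp [invSubX, hk']
  | succ n =>
    rw [coeff_succ_X_mul, coeff_invSubX, coeff_invSubX, coeff_one]
    simp only [Nat.add_eq_zero_iff, one_ne_zero, and_false, if_false]
    field_simp
    ring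

theorem sub_X_mul_invSubX' (k : ℕ) :
    ((k : ℝ⟦X⟧) - X) * invSubX k = if k = 0 then 0 else 1 := by
  split_ifs with h
  · simp [h, invSubX_zero]
  · exact sub_X_mul_invSubX h

theorem natCast_sub_two_mul_X_ne_zero {k : ℕ} (hk : k ≠ 0) :
    (k : ℝ⟦X⟧) - 2 * X ≠ 0 := by
  intro h
  have := congrArg (constantCoeff (R := ℝ)) h
  simp at this
  exact hk this

theorem sub_two_mul_X_mul_invSubTwoX {k : ℕ} (hk : k ≠ 0) :
    ((k : ℝ⟦X⟧) - 2 * X) * invSubTwoX k = 1 := by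
  have hk' : (k : ℝ) ≠ 0 := by exact_mod_cast hk
  have hC : (k : ℝ⟦X⟧) - 2 * X = C (k : ℝ) - C 2 * X := by simp [map_ofNat]
  ext n
  rw [hC, sub_mul, map_sub, coeff_C_mul, mul_assoc, coeff_C_mul]
  cases n with
  | zero => simp [invSubTwoX, hk']
  | succ n =>
    rw [coeff_succ_X_mul, coeff_invSubTwoX, coeff_invSubTwoX, coeff_one]
    simp only [Nat.add_eq_zero_iff, one_ne_zero, and_false, if_false]
    field_simp
    ring

theorem derivative_invSubX (k : ℕ) : d⁄dX ℝ (invSubX k) = invSubX k ^ 2 := by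
  rcases eq_or_ne k 0 with rfl | hk
  · simp [invSubX_zero]
  have h := sub_X_mul_invSubX hk
  have h2 := congrArg (d⁄dX ℝ) h
  rw [Derivation.leibniz] at h2
  simp only [map_sub, Derivation.map_natCast, derivative_X, smul_eq_mul, derivative_one] at h2
  linear_combination invSubX k * h2 - (d⁄dX ℝ (invSubX k)) * h

theorem esymmInv_zero (m : ℕ) : esymmInv 0 m = 1 := rfl

theorem esymmInv_succ (n m : ℕ) :
    esymmInv (n + 1) m = ∑ k ∈ range m, invSubX k * esymmInv n k := rfl

theorem esymmInv_succ_zero (n : ℕ) : esymmInv (n + 1) 0 = 0 := by simp [esymmInv_succ]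

theorem esymmInv_succ_succ (n m : ℕ) :
    esymmInv (n + 1) (m + 1) = esymmInv (n + 1) m + invSubX m * esymmInv n m := by
  simp [esymmInv_succ, sum_range_succ]

theorem psumInv_succ (r m : ℕ) : psumInv r (m + 1) = psumInv r m + invSubX m ^ r := by
  simp [psumInv, sum_range_succ]

theorem psumInv_eq_sum (r m : ℕ) : psumInv r m = ∑ k ∈ range m, invSubX k ^ r := rfl

theorem esymmInv_one_eq_sum (m : ℕ) : esymmInv 1 m = ∑ k ∈ range m, invSubX k := by
  simp [esymmInv_succ, esymmInv_zero]

theorem esymmInv_one (m : ℕ) : esymmInv 1 m = psumInv 1 m := by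
  simp [esymmInv_one_eq_sum, psumInv]

/-- Newton's identities: adjoining the variable `1 / (m - X)` changes each elementary symmetric
function by that variable times the previous one, so induction on `m` reduces each degree to the one
below. -/
theorem esymmInv_two (m : ℕ) :
    esymmInv 2 m = C (1 / 2) * (esymmInv 1 m ^ 2 - psumInv 2 m) := by
  have hc : C (1 / 2 : ℝ) * 2 = 1 := by
    rw [← map_ofNat (C (R := ℝ)) 2, ← map_mul]; norm_num
  induction m with
  | zero => simp [esymmInv_succ_zero, psumInv]
  | succ m ih =>
    rw [esymmInv_succ_succ, esymmInv_succ_succ, psumInv_succ, esymmInv_zero, ih]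
    linear_combination (-(invSubX m * esymmInv 1 m)) * hc

theorem esymmInv_three (m : ℕ) :
    esymmInv 3 m = C (1 / 6) * (esymmInv 1 m ^ 3 - 3 * esymmInv 1 m * psumInv 2 m
      + 2 * psumInv 3 m) := by
  have hc : C (1 / 2 : ℝ) = 3 * C (1 / 6) := by
    rw [← map_ofNat (C (R := ℝ)) 3, ← map_mul]; norm_num
  induction m with
  | zero => simp [esymmInv_succ_zero, psumInv]
  | succ m ih =>
    rw [esymmInv_succ_succ, esymmInv_succ_succ 0, psumInv_succ, psumInv_succ, esymmInv_zero,
      ih, esymmInv_two]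
    linear_combination invSubX m * (esymmInv 1 m ^ 2 - psumInv 2 m) * hc

theorem esymmInv_four (m : ℕ) :
    esymmInv 4 m = C (1 / 24) * (esymmInv 1 m ^ 4 - 6 * esymmInv 1 m ^ 2 * psumInv 2 m
      + 3 * psumInv 2 m ^ 2 + 8 * esymmInv 1 m * psumInv 3 m - 6 * psumInv 4 m) := by
  have hc : C (1 / 6 : ℝ) = 4 * C (1 / 24) := by
    rw [← map_ofNat (C (R := ℝ)) 4, ← map_mul]; norm_num
  induction m with
  | zero => simp [esymmInv_succ_zero, psumInv]
  | succ m ih =>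
    rw [esymmInv_succ_succ, esymmInv_succ_succ 0, psumInv_succ, psumInv_succ, psumInv_succ,
      esymmInv_zero, ih, esymmInv_three]
    linear_combination invSubX m * (esymmInv 1 m ^ 3 - 3 * esymmInv 1 m * psumInv 2 m
      + 2 * psumInv 3 m) * hc

theorem derivative_psumInv (r m : ℕ) :
    d⁄dX ℝ (psumInv r m) = r * psumInv (r + 1) m := by
  rw [psumInv, psumInv, map_sum, mul_sum]
  refine sum_congr rfl fun k _ => ?_
  rw [Derivation.leibniz_pow, derivative_invSubX]
  rcases r with _ | r
  · simp
  · simp only [smul_eq_mul, nsmul_eq_mul, Nat.add_sub_cancel]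
    ring

theorem derivative_esymmInv_one (m : ℕ) : d⁄dX ℝ (esymmInv 1 m) = psumInv 2 m := by
  rw [esymmInv_one, derivative_psumInv]; simp

/-! ### Partial fractions along antidiagonals -/

/-- A convolution with partial sums may be moved from one factor to the other. -/
theorem sum_antidiagonal_mul_sum_range {R : Type*} [CommRing R] (x y : ℕ → R) (m : ℕ) :
    ∑ s ∈ antidiagonal m, x s.1 * ∑ j ∈ range s.2, y j =
      ∑ s ∈ antidiagonal m, (∑ i ∈ range s.1, x i) * y s.2 := by
  induction m with
  | zero => simp
  | succ m ih =>
    rw [Finset.Nat.sum_antidiagonal_succ', Finset.Nat.sum_antidiagonal_succ]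
    simp only [range_zero, sum_empty, mul_zero, zero_mul, zero_add, sum_range_succ, mul_add,
      add_mul, sum_add_distrib, ih]

theorem sum_antidiagonal_swap_eq {R : Type*} [AddCommMonoid R] (f : ℕ → ℕ → R) (m : ℕ) :
    ∑ s ∈ antidiagonal m, f s.1 s.2 = ∑ s ∈ antidiagonal m, f s.2 s.1 := by
  exact (Finset.Nat.sum_antidiagonal_swap (f := fun s => f s.1 s.2)).symm

/-- Cancelling `p - X` leaves the indicator of `p ≠ 0`, because `invSubX 0 = 0`; the convolution
then collapses to a partial sum over `q < m`. -/
theorem sum_antidiagonal_ne_zero_left {R : Type*} [CommRing R] (f : ℕ → R) (m : ℕ) :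
    ∑ s ∈ antidiagonal m, (if s.1 = 0 then 0 else 1) * f s.2 = ∑ k ∈ range m, f k := by
  cases m with
  | zero => simp
  | succ m =>
    rw [Finset.Nat.sum_antidiagonal_succ]
    simp only [if_true, zero_mul, zero_add, Nat.add_eq_zero_iff, one_ne_zero, and_false, if_false,
      one_mul]
    rw [Finset.Nat.sum_antidiagonal_eq_sum_range_succ_mk]
    rw [← sum_range_reflect]
    refine sum_congr rfl fun i hi => ?_
    simp at hi
    congr 1
    dsimp only
    omega

theorem derivative_esymmInv_two (m : ℕ) :
    d⁄dX ℝ (esymmInv 2 m) =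
      ∑ k ∈ range m, (invSubX k ^ 2 * esymmInv 1 k + invSubX k * psumInv 2 k) := by
  rw [esymmInv_succ, map_sum]
  refine sum_congr rfl fun k _ => ?_
  rw [Derivation.leibniz, derivative_invSubX, derivative_esymmInv_one]
  simp only [smul_eq_mul]
  ring

theorem derivative_derivative_esymmInv_one (m : ℕ) :
    d⁄dX ℝ (d⁄dX ℝ (esymmInv 1 m)) = 2 * psumInv 3 m := by
  rw [derivative_esymmInv_one, derivative_psumInv]; norm_num

/-- Partial fractions: a convolution of `x` and `y` is divided by `m - 2 X`. -/
theorem eq_invSubTwoX_mul {m : ℕ} {f : ℕ → ℕ → ℝ⟦X⟧} {g : ℝ⟦X⟧} (h0 : f 0 0 = 0)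
    (h : ∑ s ∈ antidiagonal m, (((s.1 : ℝ⟦X⟧) - X) + ((s.2 : ℝ⟦X⟧) - X)) * f s.1 s.2 = g) :
    ∑ s ∈ antidiagonal m, f s.1 s.2 = invSubTwoX m * g := by
  rcases eq_or_ne m 0 with rfl | hm
  · have : invSubTwoX 0 = 0 := by ext n; simp [invSubTwoX]
    simp [this, h0]
  · refine mul_left_cancel₀ (natCast_sub_two_mul_X_ne_zero hm) ?_
    rw [← mul_assoc, sub_two_mul_X_mul_invSubTwoX hm, one_mul, ← h, mul_sum]
    refine sum_congr rfl fun s hs => ?_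
    rw [← mem_antidiagonal.1 hs]
    push_cast
    ring

/-- The kernel of the shuffle identity for `esymmInv 3`. -/
noncomputable def shuffleKernelThree (p q : ℕ) : ℝ⟦X⟧ :=
  invSubX p * (invSubX q * esymmInv 2 q)
    - C (1 / 2) * ((invSubX p * esymmInv 1 p) * (invSubX q * esymmInv 1 q))

/-- The kernel of the shuffle identity for the derivative of `esymmInv 2`. -/
noncomputable def shuffleKernelTwo (p q : ℕ) : ℝ⟦X⟧ :=
  invSubX p * (invSubX q ^ 2 * esymmInv 1 q + invSubX q * psumInv 2 q)
    - invSubX p ^ 2 * (invSubX q * esymmInv 1 q)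

/-- The kernel of the shuffle identity for the second derivative of `esymmInv 1`. -/
noncomputable def shuffleKernelOne (p q : ℕ) : ℝ⟦X⟧ :=
  2 * (invSubX p * invSubX q ^ 3) - invSubX p ^ 2 * invSubX q ^ 2

/-- Here and in the next three lemmas the indicator left by `sub_X_mul_invSubX'` is absorbed by a
factor that vanishes at `0`. -/
theorem ite_mul_esymmInv_one (k : ℕ) :
    (if k = 0 then (0 : ℝ⟦X⟧) else 1) * esymmInv 1 k = esymmInv 1 k := by
  split_ifs with h
  · simp [h, esymmInv_succ_zero]
  · rw [one_mul]

theorem ite_mul_esymmInv_two (k : ℕ) :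
    (if k = 0 then (0 : ℝ⟦X⟧) else 1) * esymmInv 2 k = esymmInv 2 k := by
  split_ifs with h
  · simp [h, esymmInv_succ_zero]
  · rw [one_mul]

theorem ite_mul_psumInv_two (k : ℕ) :
    (if k = 0 then (0 : ℝ⟦X⟧) else 1) * psumInv 2 k = psumInv 2 k := by
  split_ifs with h
  · simp [h, psumInv]
  · rw [one_mul]

theorem ite_mul_invSubX (k : ℕ) :
    (if k = 0 then (0 : ℝ⟦X⟧) else 1) * invSubX k = invSubX k := by
  split_ifs with h
  · simp [h, invSubX_zero]
  · rw [one_mul]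

/-- Multiplying by `p - X` or `q - X` removes one factor. One term sums to `esymmInv 3 m`; the
others cancel. -/
theorem sum_shuffleKernelThree (m : ℕ) :
    ∑ s ∈ antidiagonal m, shuffleKernelThree s.1 s.2 = invSubTwoX m * esymmInv 3 m := by
  refine eq_invSubTwoX_mul (by simp [shuffleKernelThree, invSubX_zero]) ?_
  have key (p q : ℕ) : (((p : ℝ⟦X⟧) - X) + ((q : ℝ⟦X⟧) - X)) * shuffleKernelThree p q =
      (if p = 0 then 0 else 1) * (invSubX q * esymmInv 2 q)
      + invSubX p * esymmInv 2 q
      - C (1 / 2) * (esymmInv 1 p * (invSubX q * esymmInv 1 q))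
      - C (1 / 2) * ((invSubX p * esymmInv 1 p) * esymmInv 1 q) := by
    have h1 := sub_X_mul_invSubX' p
    have h2 := sub_X_mul_invSubX' q
    have h3 := ite_mul_esymmInv_one p
    have h4 := ite_mul_esymmInv_one q
    have h5 := ite_mul_esymmInv_two q
    rw [shuffleKernelThree]
    linear_combination (invSubX q * esymmInv 2 q - C (1 / 2) * esymmInv 1 p *
      (invSubX q * esymmInv 1 q)) * h1 + (invSubX p * esymmInv 2 q
      - C (1 / 2) * invSubX p * esymmInv 1 p * esymmInv 1 q) * h2
      - C (1 / 2) * (invSubX q * esymmInv 1 q) * h3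
      - C (1 / 2) * invSubX p * esymmInv 1 p * h4 + invSubX p * h5
  simp only [key, sum_add_distrib, sum_sub_distrib, ← mul_sum]
  rw [sum_antidiagonal_ne_zero_left fun k => invSubX k * esymmInv 2 k, ← esymmInv_succ,
    sum_antidiagonal_swap_eq fun p q => (invSubX p * esymmInv 1 p) * esymmInv 1 q]
  -- `esymmInv 2` is itself a partial sum, so `1 / (p - X) * E_2(q)` convolves to `E_1(p) * E_1(q) /
  -- (q - X)`. This equals the two halves coming from the square term.
  have hconv := sum_antidiagonal_mul_sum_range invSubX (fun k => invSubX k * esymmInv 1 k) m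
  simp only [← esymmInv_succ, ← esymmInv_one_eq_sum] at hconv
  rw [hconv]
  have hc : C (1 / 2 : ℝ) * 2 = 1 := by
    rw [← map_ofNat (C (R := ℝ)) 2, ← map_mul]; norm_num
  simp only [mul_comm (_ * esymmInv 1 _) (esymmInv 1 _)]
  linear_combination (-∑ s ∈ antidiagonal m,
    esymmInv 1 s.1 * (invSubX s.2 * esymmInv 1 s.2)) * hc

theorem sum_shuffleKernelTwo (m : ℕ) :
    ∑ s ∈ antidiagonal m, shuffleKernelTwo s.1 s.2 =
      invSubTwoX m * d⁄dX ℝ (esymmInv 2 m) := by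
  refine eq_invSubTwoX_mul (by simp [shuffleKernelTwo, invSubX_zero]) ?_
  have key (p q : ℕ) : (((p : ℝ⟦X⟧) - X) + ((q : ℝ⟦X⟧) - X)) * shuffleKernelTwo p q =
      (if p = 0 then 0 else 1) * (invSubX q ^ 2 * esymmInv 1 q + invSubX q * psumInv 2 q)
      + invSubX p * psumInv 2 q - invSubX p ^ 2 * esymmInv 1 q := by
    have h1 := sub_X_mul_invSubX' p
    have h2 := sub_X_mul_invSubX' q
    have h3 := ite_mul_invSubX p
    have h4 := ite_mul_invSubX q
    have h5 := ite_mul_esymmInv_one q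
    have h6 := ite_mul_psumInv_two q
    rw [shuffleKernelTwo]
    linear_combination (invSubX q ^ 2 * esymmInv 1 q + invSubX q * psumInv 2 q
      - invSubX p * (invSubX q * esymmInv 1 q)) * h1
      + (invSubX p * (invSubX q * esymmInv 1 q + psumInv 2 q)
      - invSubX p ^ 2 * esymmInv 1 q) * h2 - invSubX q * esymmInv 1 q * h3
      + invSubX p * esymmInv 1 q * h4 - invSubX p ^ 2 * h5 + invSubX p * h6
  simp only [key, sum_add_distrib, sum_sub_distrib]
  rw [sum_antidiagonal_ne_zero_left fun k => invSubX k ^ 2 * esymmInv 1 k + invSubX k * psumInv 2 k,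
    ← derivative_esymmInv_two,
    sum_antidiagonal_swap_eq fun p q => invSubX p ^ 2 * esymmInv 1 q]
  have hconv := sum_antidiagonal_mul_sum_range invSubX (fun k => invSubX k ^ 2) m
  simp only [← psumInv_eq_sum, ← esymmInv_one_eq_sum] at hconv
  rw [hconv]
  simp only [mul_comm (_ ^ 2) (esymmInv 1 _)]
  ring

/-- Apart from the main term the residue is antisymmetric in `p` and `q`, so it sums to zero. -/
theorem sum_shuffleKernelOne (m : ℕ) :
    ∑ s ∈ antidiagonal m, shuffleKernelOne s.1 s.2 =
      invSubTwoX m * d⁄dX ℝ (d⁄dX ℝ (esymmInv 1 m)) := by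
  refine eq_invSubTwoX_mul (by simp [shuffleKernelOne, invSubX_zero]) ?_
  have key (p q : ℕ) : (((p : ℝ⟦X⟧) - X) + ((q : ℝ⟦X⟧) - X)) * shuffleKernelOne p q =
      2 * ((if p = 0 then 0 else 1) * invSubX q ^ 3)
      + invSubX p * invSubX q ^ 2 - invSubX p ^ 2 * invSubX q := by
    have h1 := sub_X_mul_invSubX' p
    have h2 := sub_X_mul_invSubX' q
    have h3 := ite_mul_invSubX p
    have h4 := ite_mul_invSubX q
    rw [shuffleKernelOne]
    linear_combination (2 * invSubX q ^ 3 - invSubX p * invSubX q ^ 2) * h1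
      + (2 * invSubX p * invSubX q ^ 2 - invSubX p ^ 2 * invSubX q) * h2
      - invSubX q ^ 2 * h3 + (2 * invSubX p * invSubX q - invSubX p ^ 2) * h4
  simp only [key, sum_add_distrib, sum_sub_distrib, ← mul_sum]
  rw [sum_antidiagonal_ne_zero_left fun k => invSubX k ^ 3, ← psumInv_eq_sum,
    ← derivative_derivative_esymmInv_one,
    sum_antidiagonal_swap_eq fun p q => invSubX p ^ 2 * invSubX q]
  simp only [mul_comm (_ ^ 2) (invSubX _)]
  ring

/-! ### From the triangle to the square -/

/-- The pairs `(p, q)` with `p, q < M ≤ p + q`. -/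
def corner (M : ℕ) : Finset (ℕ × ℕ) := {s ∈ range M ×ˢ range M | M ≤ s.1 + s.2}

theorem mem_corner {M : ℕ} {s : ℕ × ℕ} :
    s ∈ corner M ↔ s.1 < M ∧ s.2 < M ∧ M ≤ s.1 + s.2 := by
  simp [corner, and_assoc]

theorem sum_antidiagonal_add_sum_corner {R : Type*} [AddCommMonoid R] (f : ℕ → ℕ → R) (M : ℕ) :
    ∑ m ∈ range M, ∑ s ∈ antidiagonal m, f s.1 s.2 + ∑ s ∈ corner M, f s.1 s.2 =
      ∑ p ∈ range M, ∑ q ∈ range M, f p q := by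
  rw [← sum_product' (range M) (range M) f, corner,
    ← sum_filter_not_add_sum_filter (range M ×ˢ range M) (fun s => M ≤ s.1 + s.2)]
  congr 1
  rw [← sum_fiberwise_of_maps_to (g := fun s : ℕ × ℕ => s.1 + s.2) (t := range M)]
  · refine sum_congr rfl fun m hm => sum_congr ?_ fun _ _ => rfl
    ext s
    simp at hm ⊢
    omega
  · intro s hs
    simp at hs ⊢
    omega

theorem sum_corner_swap {R : Type*} [AddCommMonoid R] (f : ℕ → ℕ → R) (M : ℕ) :
    ∑ s ∈ corner M, f s.1 s.2 = ∑ s ∈ corner M, f s.2 s.1 := by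
  refine sum_nbij' Prod.swap Prod.swap ?_ ?_ ?_ ?_ ?_ <;>
    simp +contextual [mem_corner, add_comm]

/-- The corner is symmetric, so its kernel may be symmetrized. Only then do the differences `E_1(p)
- E_1(q)` appear, whose coefficients decay. -/
theorem sum_corner_symm {f g : ℕ → ℕ → ℝ⟦X⟧}
    (h : ∀ p q, C (1 / 2) * (f p q + f q p) = g p q) (M : ℕ) :
    ∑ s ∈ corner M, f s.1 s.2 = ∑ s ∈ corner M, g s.1 s.2 := by
  have hswap := sum_corner_swap f M
  have hc : C (1 / 2 : ℝ) * 2 = 1 := by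
    rw [← map_ofNat (C (R := ℝ)) 2, ← map_mul]; norm_num
  simp only [← h, ← mul_sum, sum_add_distrib, ← hswap]
  linear_combination (-∑ s ∈ corner M, f s.1 s.2) * hc

/-- The symmetrized kernel `shuffleKernelThree`. -/
noncomputable def cornerKernelThree (p q : ℕ) : ℝ⟦X⟧ :=
  C (1 / 4) * (invSubX p * invSubX q *
    ((esymmInv 1 p - esymmInv 1 q) ^ 2 - (psumInv 2 p + psumInv 2 q)))

/-- The symmetrized kernel of the sum of the three shuffle identities. -/
noncomputable def cornerKernelTotal (p q : ℕ) : ℝ⟦X⟧ :=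
  C (1 / 4) * (invSubX p * invSubX q *
    ((esymmInv 1 p - esymmInv 1 q) ^ 2
      + (invSubX p - invSubX q) * (esymmInv 1 p - esymmInv 1 q)
      + C (1 / 2) * (invSubX p ^ 2 + invSubX q ^ 2 - invSubX p * invSubX q)))

theorem sum_invSubTwoX_mul_esymmInv_three (M : ℕ) :
    ∑ m ∈ range M, invSubTwoX m * esymmInv 3 m =
      esymmInv 4 M + C (1 / 4) * (psumInv 4 M - psumInv 2 M ^ 2)
        - ∑ s ∈ corner M, cornerKernelThree s.1 s.2 := by
  have hsymm : ∑ s ∈ corner M, shuffleKernelThree s.1 s.2 =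
      ∑ s ∈ corner M, cornerKernelThree s.1 s.2 := by
    refine sum_corner_symm (fun p q => ?_) M
    rw [shuffleKernelThree, shuffleKernelThree, cornerKernelThree, esymmInv_two, esymmInv_two]
    have h1 : C (1 / 2 : ℝ) = 2 * C (1 / 4) := by
      rw [← map_ofNat (C (R := ℝ)) 2, ← map_mul]; norm_num
    have h2 : C (1 / 4 : ℝ) * 4 = 1 := by
      rw [← map_ofNat (C (R := ℝ)) 4, ← map_mul]; norm_num
    rw [h1]
    linear_combination (C (1 / 4 : ℝ)) * invSubX p * invSubX q * (esymmInv 1 p ^ 2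
      + esymmInv 1 q ^ 2 - psumInv 2 p - psumInv 2 q - 2 * esymmInv 1 p * esymmInv 1 q) * h2
  rw [← hsymm, eq_sub_iff_add_eq]
  simp only [← sum_shuffleKernelThree]
  rw [sum_antidiagonal_add_sum_corner]
  simp only [shuffleKernelThree, sum_sub_distrib, ← mul_sum, ← sum_mul, ← esymmInv_succ,
    ← esymmInv_one_eq_sum]
  -- The square has become `E_1 E_3 - E_2² / 2`; the rest is Newton's identities.
  rw [esymmInv_three, esymmInv_four, esymmInv_two]
  have h1 : C (1 / 2 : ℝ) = 12 * C (1 / 24) := by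
    rw [← map_ofNat (C (R := ℝ)) 12, ← map_mul]; norm_num
  have h2 : C (1 / 6 : ℝ) = 4 * C (1 / 24) := by
    rw [← map_ofNat (C (R := ℝ)) 4, ← map_mul]; norm_num
  have h3 : C (1 / 4 : ℝ) = 6 * C (1 / 24) := by
    rw [← map_ofNat (C (R := ℝ)) 6, ← map_mul]; norm_num
  have h4 : C (1 / 24 : ℝ) * 24 = 1 := by
    rw [← map_ofNat (C (R := ℝ)) 24, ← map_mul]; norm_num
  rw [h1, h2, h3]
  linear_combination (-3 * (C (1 / 24 : ℝ)) * (esymmInv 1 M ^ 2 - psumInv 2 M) ^ 2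
    * (C (1 / 24 : ℝ) * 24 + 1)) * h4

/-- The tail in the first identity. -/
noncomputable def esymmTail (m : ℕ) : ℝ⟦X⟧ :=
  esymmInv 3 m + C (1 / 2) * d⁄dX ℝ (esymmInv 2 m)
    + C (1 / 8) * d⁄dX ℝ (d⁄dX ℝ (esymmInv 1 m))

/-- The weights `1, 1/2, 1/8` make `psumInv 2` cancel in the symmetrized kernel, which is the
obstruction to its decay. -/
theorem sum_invSubTwoX_mul_esymmTail (M : ℕ) :
    ∑ m ∈ range M, invSubTwoX m * esymmTail m =
      esymmInv 4 M + C (1 / 2) * d⁄dX ℝ (esymmInv 3 M)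
        + C (1 / 8) * d⁄dX ℝ (d⁄dX ℝ (esymmInv 2 M))
        + C (1 / 48) * d⁄dX ℝ (d⁄dX ℝ (d⁄dX ℝ (esymmInv 1 M)))
        - ∑ s ∈ corner M, cornerKernelTotal s.1 s.2 := by
  have h1 : C (1 / 2 : ℝ) = 24 * C (1 / 48) := by
    rw [← map_ofNat (C (R := ℝ)) 24, ← map_mul]; norm_num
  have h2 : C (1 / 6 : ℝ) = 8 * C (1 / 48) := by
    rw [← map_ofNat (C (R := ℝ)) 8, ← map_mul]; norm_num
  have h3 : C (1 / 8 : ℝ) = 6 * C (1 / 48) := by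
    rw [← map_ofNat (C (R := ℝ)) 6, ← map_mul]; norm_num
  have h5 : C (1 / 4 : ℝ) = 12 * C (1 / 48) := by
    rw [← map_ofNat (C (R := ℝ)) 12, ← map_mul]; norm_num
  have h6 : C (1 / 24 : ℝ) = 2 * C (1 / 48) := by
    rw [← map_ofNat (C (R := ℝ)) 2, ← map_mul]; norm_num
  have h4 : C (1 / 48 : ℝ) * 48 = 1 := by
    rw [← map_ofNat (C (R := ℝ)) 48, ← map_mul]; norm_num
  let K : ℕ → ℕ → ℝ⟦X⟧ := fun p q => shuffleKernelThree p q + C (1 / 2) * shuffleKernelTwo p q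
    + C (1 / 8) * shuffleKernelOne p q
  have hsymm : ∑ s ∈ corner M, K s.1 s.2 =
      ∑ s ∈ corner M, cornerKernelTotal s.1 s.2 := by
    refine sum_corner_symm (fun p q => ?_) M
    simp only [K]
    rw [shuffleKernelThree, shuffleKernelThree, shuffleKernelTwo, shuffleKernelTwo,
      shuffleKernelOne, shuffleKernelOne, cornerKernelTotal, esymmInv_two, esymmInv_two,
      h1, h3, h5]
    clear h1 h2 h3 h5 h6
    -- All scalars are multiples of `1 / 48`, so a polynomial identity modulo `u * 48 = 1` remains.
    generalize C (1 / 48 : ℝ) = u at h4 ⊢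
    grind
  have hdiag (m : ℕ) : invSubTwoX m * esymmTail m = ∑ s ∈ antidiagonal m, K s.1 s.2 := by
    simp only [K, sum_add_distrib, ← mul_sum, sum_shuffleKernelThree, sum_shuffleKernelTwo,
      sum_shuffleKernelOne, esymmTail]
    ring
  rw [← hsymm, eq_sub_iff_add_eq]
  simp only [hdiag]
  rw [sum_antidiagonal_add_sum_corner]
  simp only [K, shuffleKernelThree, shuffleKernelTwo, shuffleKernelOne, sum_sub_distrib,
    sum_add_distrib, ← mul_sum, ← sum_mul, ← esymmInv_succ, ← esymmInv_one_eq_sum]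
  simp only [← sum_add_distrib, ← derivative_esymmInv_two, ← psumInv_eq_sum]
  have d1 := derivative_esymmInv_one M
  have d2 : d⁄dX ℝ (psumInv 2 M) = 2 * psumInv 3 M := by rw [derivative_psumInv]; norm_num
  have d3 : d⁄dX ℝ (psumInv 3 M) = 3 * psumInv 4 M := by rw [derivative_psumInv]; norm_num
  have e2 : d⁄dX ℝ (2 : ℝ⟦X⟧) = 0 := (d⁄dX ℝ).map_natCast 2
  have e3 : d⁄dX ℝ (3 : ℝ⟦X⟧) = 0 := (d⁄dX ℝ).map_natCast 3
  have f2 : d⁄dX ℝ (esymmInv 2 M) =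
      C (1 / 2) * (2 * esymmInv 1 M * psumInv 2 M - 2 * psumInv 3 M) := by
    simp only [esymmInv_two, Derivation.leibniz, map_sub, sq, derivative_C, d1, d2, smul_eq_mul]
    ring
  have f3 : d⁄dX ℝ (esymmInv 3 M) =
      C (1 / 6) * (3 * esymmInv 1 M ^ 2 * psumInv 2 M
        - 3 * (psumInv 2 M ^ 2 + 2 * esymmInv 1 M * psumInv 3 M) + 6 * psumInv 4 M) := by
    simp only [esymmInv_three, Derivation.leibniz, map_sub, map_add, pow_succ, pow_zero, one_mul,
      derivative_C, d1, d2, d3, e2, e3, smul_eq_mul]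
    ring
  have f22 : d⁄dX ℝ (d⁄dX ℝ (esymmInv 2 M)) =
      C (1 / 2) * (2 * psumInv 2 M ^ 2 + 4 * esymmInv 1 M * psumInv 3 M - 6 * psumInv 4 M) := by
    simp only [f2, Derivation.leibniz, map_sub, derivative_C, d1, d2, d3, e2, smul_eq_mul]
    ring
  have f11 : d⁄dX ℝ (2 * psumInv 3 M) = 6 * psumInv 4 M := by
    simp only [Derivation.leibniz, d3, e2, smul_eq_mul]
    ring
  rw [f3, f22, f2, d1, d2, f11, esymmInv_four, esymmInv_three, esymmInv_two, h1, h2, h3, h6]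
  clear d1 d2 d3 e2 e3 f2 f3 f22 f11 h1 h2 h3 h5 h6 hsymm hdiag
  generalize C (1 / 48 : ℝ) = u at h4 ⊢
  grind

/-! ### Geometric majorants for coefficients -/

/-- The coefficients of `f` are bounded by those of `c / (1 - r X)`. -/
def CoeffBound (f : ℝ⟦X⟧) (c r : ℝ) : Prop := ∀ n, |coeff n f| ≤ c * r ^ n

namespace CoeffBound

variable {f g : ℝ⟦X⟧} {c d r s : ℝ}

theorem nonneg (hf : CoeffBound f c r) : 0 ≤ c := by
  have := (abs_nonneg _).trans (hf 0)
  simpa using this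

theorem mono (hf : CoeffBound f c r) (hr : 0 ≤ r) (hc : c ≤ d) (hs : r ≤ s) :
    CoeffBound f d s := fun n =>
  (hf n).trans (mul_le_mul hc (pow_le_pow_left₀ hr hs n) (pow_nonneg hr n)
    (hf.nonneg.trans hc))

theorem add (hf : CoeffBound f c r) (hg : CoeffBound g d r) : CoeffBound (f + g) (c + d) r :=
  fun n => by
    rw [map_add, add_mul]
    exact (abs_add_le _ _).trans (add_le_add (hf n) (hg n))

theorem neg (hf : CoeffBound f c r) : CoeffBound (-f) c r := fun n => by
  rw [map_neg, abs_neg]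
  exact hf n

theorem sub (hf : CoeffBound f c r) (hg : CoeffBound g d r) : CoeffBound (f - g) (c + d) r := by
  rw [sub_eq_add_neg]
  exact hf.add hg.neg

/-- Binomial coefficients are at least `1`, so the convolution of `r ^ i` and `s ^ j` is at most `(r
+ s) ^ n`. Adding the ratios avoids a polynomial factor in `n`. -/
theorem mul (hf : CoeffBound f c r) (hg : CoeffBound g d s) (hr : 0 ≤ r) (hs : 0 ≤ s) :
    CoeffBound (f * g) (c * d) (r + s) := fun n => by
  rw [coeff_mul]
  calc |∑ p ∈ antidiagonal n, coeff p.1 f * coeff p.2 g|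
      ≤ ∑ p ∈ antidiagonal n, (c * d) * (r ^ p.1 * s ^ p.2 * (n.choose p.1)) := by
        refine (abs_sum_le_sum_abs _ _).trans (sum_le_sum fun p hp => ?_)
        rw [abs_mul]
        have h1 : (1 : ℝ) ≤ n.choose p.1 := by
          have h : p.1 ≤ n := by have := mem_antidiagonal.1 hp; omega
          exact_mod_cast Nat.choose_pos h
        calc |coeff p.1 f| * |coeff p.2 g| ≤ (c * r ^ p.1) * (d * s ^ p.2) :=
              mul_le_mul (hf _) (hg _) (abs_nonneg _) (mul_nonneg hf.nonneg (pow_nonneg hr _))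
          _ = (c * d) * (r ^ p.1 * s ^ p.2 * 1) := by ring
          _ ≤ _ := by
              have := hf.nonneg
              have := hg.nonneg
              gcongr
    _ = c * d * (r + s) ^ n := by
        rw [← mul_sum, (Commute.all r s).add_pow', sum_congr rfl]
        intro p _
        simp [mul_comm]

theorem sum {ι : Type*} {t : Finset ι} {F : ι → ℝ⟦X⟧} {c : ι → ℝ}
    (h : ∀ i ∈ t, CoeffBound (F i) (c i) r) : CoeffBound (∑ i ∈ t, F i) (∑ i ∈ t, c i) r :=
  fun n => by
    rw [map_sum, sum_mul]
    exact (abs_sum_le_sum_abs _ _).trans (sum_le_sum fun i hi => h i hi n)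

theorem const (x : ℝ) : CoeffBound (C x) |x| 0 := fun n => by
  cases n <;> simp [coeff_C]

theorem C_mul (hf : CoeffBound f c r) {x : ℝ} (hx : 0 ≤ x) : CoeffBound (C x * f) (x * c) r :=
  fun n => by
    rw [coeff_C_mul, abs_mul, abs_of_nonneg hx, mul_assoc]
    exact mul_le_mul_of_nonneg_left (hf n) hx

end CoeffBound

theorem coeffBound_invSubX {p k : ℕ} (hp : p ≠ 0) (h : p ≤ k) :
    CoeffBound (invSubX k) (1 / k) (1 / p) := fun n => by
  have hp' : (0 : ℝ) < p := by exact_mod_cast Nat.pos_of_ne_zero hp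
  have hpk : (p : ℝ) ≤ k := by exact_mod_cast h
  have hk' : (0 : ℝ) < k := hp'.trans_le hpk
  rw [coeff_invSubX, abs_of_nonneg (by positivity), pow_succ, one_div_pow,
    div_mul_div_comm, one_mul, mul_comm]
  gcongr

theorem coeffBound_invSubX_one (k : ℕ) : CoeffBound (invSubX k) (1 / k) 1 := by
  rcases eq_or_ne k 0 with rfl | hk
  · intro n; simp [invSubX_zero]
  · simpa using coeffBound_invSubX one_ne_zero (Nat.one_le_iff_ne_zero.2 hk)

/-! ### Harmonic sums -/

/-- The harmonic sum over `0 < k < m`. -/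
noncomputable def harmonicSum (m : ℕ) : ℝ := ∑ k ∈ range m, 1 / (k : ℝ)

theorem harmonicSum_succ (m : ℕ) : harmonicSum (m + 1) = harmonicSum m + 1 / m := by
  simp [harmonicSum, sum_range_succ]

theorem harmonicSum_nonneg (m : ℕ) : 0 ≤ harmonicSum m :=
  sum_nonneg fun _ _ => by positivity

theorem harmonicSum_mono : Monotone harmonicSum :=
  monotone_nat_of_le_succ fun m => by
    rw [harmonicSum_succ]
    have : (0 : ℝ) ≤ 1 / m := by positivity
    linarith

theorem one_le_harmonicSum {m : ℕ} (hm : 2 ≤ m) : 1 ≤ harmonicSum m := by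
  refine le_trans ?_ (harmonicSum_mono hm)
  simp [harmonicSum, sum_range_succ]

theorem tendsto_harmonicSum_pow_div (b : ℕ) :
    Tendsto (fun M : ℕ => harmonicSum (M + 1) ^ b / M) atTop (𝓝 0) := by
  have hle (M : ℕ) : harmonicSum (M + 1) ≤ 1 + Real.log M := by
    refine le_trans (le_of_eq ?_) (harmonic_le_one_add_log M)
    rw [harmonicSum, sum_range_succ']
    simp [harmonic]
  have hlim : Tendsto (fun M : ℕ => (2 * Real.log M) ^ b / M) atTop (𝓝 0) := by
    have h := (isLittleO_log_rpow_rpow_atTop (b : ℝ) one_pos).tendsto_div_nhds_zero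
    have h' := (h.comp tendsto_natCast_atTop_atTop).const_mul ((2 : ℝ) ^ b)
    rw [mul_zero] at h'
    refine h'.congr fun M => ?_
    simp [mul_pow, mul_div_assoc]
  refine squeeze_zero' (Eventually.of_forall fun M =>
    div_nonneg (pow_nonneg (harmonicSum_nonneg _) _) (Nat.cast_nonneg _)) ?_ hlim
  have hlog : ∀ᶠ M : ℕ in atTop, 1 ≤ Real.log M :=
    (Real.tendsto_log_atTop.comp tendsto_natCast_atTop_atTop).eventually_ge_atTop 1
  filter_upwards [hlog] with M hM
  have := harmonicSum_nonneg (M + 1)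
  have h2 := hle M
  have h3 : harmonicSum (M + 1) ≤ 2 * Real.log M := by linarith
  gcongr

theorem sum_one_div_succ_sq_le (I : ℕ) : ∑ i ∈ range I, 1 / ((i : ℝ) + 1) ^ 2 ≤ 2 := by
  have h := sum_Ioo_inv_sq_le (α := ℝ) 0 (I + 1)
  have h2 : ∑ i ∈ range I, 1 / ((i : ℝ) + 1) ^ 2 = ∑ i ∈ Ioo 0 (I + 1), ((i : ℝ) ^ 2)⁻¹ := by
    rw [show Ioo 0 (I + 1) = Ico 1 (I + 1) by ext; simp; omega, sum_Ico_eq_sum_range]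
    simp [add_comm]
  rw [h2]
  simpa using h

theorem coeffBound_esymmInv (n m : ℕ) :
    CoeffBound (esymmInv n m) (harmonicSum m ^ n) n := by
  induction n generalizing m with
  | zero => simpa [esymmInv_zero] using CoeffBound.const 1
  | succ n ih =>
    rw [esymmInv_succ, pow_succ', harmonicSum, sum_mul]
    refine CoeffBound.sum fun k hk => ?_
    have h := (coeffBound_invSubX_one k).mul (ih k) zero_le_one (Nat.cast_nonneg n)
    have hk' : harmonicSum k ≤ harmonicSum m := harmonicSum_mono (mem_range.1 hk).le
    have h0 := harmonicSum_nonneg k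
    refine h.mono (by positivity) ?_ (le_of_eq (by push_cast; ring))
    rw [harmonicSum] at hk' h0 ⊢
    rw [harmonicSum] at hk'
    gcongr

/-! ### The sum formula by a connected sum -/

/-- The connecting kernel in the proof of the sum formula. -/
noncomputable def sumConnector (j i : ℕ) : ℝ⟦X⟧ :=
  (∏ k ∈ range i, (((k + 1 : ℕ) : ℝ⟦X⟧) - X)) * ∏ k ∈ range (i + 1), invSubX (j + k + 1)

/-- The difference kernel in the proof of the sum formula. -/
noncomputable def sumConnectorDiff (j i : ℕ) : ℝ⟦X⟧ := sumConnector j i * invSubX (j + i + 2)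

theorem sumConnector_eq (j i : ℕ) :
    sumConnector j i = sumConnectorDiff j i * (((j + i + 2 : ℕ) : ℝ⟦X⟧) - X) := by
  have h := sub_X_mul_invSubX (k := j + i + 2) (by omega)
  rw [sumConnectorDiff]
  linear_combination (-sumConnector j i) * h

theorem sumConnector_succ_left (j i : ℕ) :
    sumConnector (j + 1) i = sumConnectorDiff j i * (((j + 1 : ℕ) : ℝ⟦X⟧) - X) := by
  have h := sub_X_mul_invSubX (k := j + 1) (by omega)
  rw [sumConnectorDiff, sumConnector, sumConnector, prod_range_succ' (fun k => invSubX (j + k + 1)),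
    prod_range_succ]
  simp only [add_zero, show ∀ k, j + 1 + k + 1 = j + (k + 1) + 1 by intro k; ring,
    show j + i + 2 = j + (i + 1) + 1 by ring]
  linear_combination (-((∏ k ∈ range i, (((k + 1 : ℕ) : ℝ⟦X⟧) - X)) *
    (∏ k ∈ range i, invSubX (j + (k + 1) + 1)) * invSubX (j + (i + 1) + 1))) * h

theorem sumConnector_succ_right (j i : ℕ) :
    sumConnector j (i + 1) = sumConnectorDiff j i * (((i + 1 : ℕ) : ℝ⟦X⟧) - X) := by
  rw [sumConnectorDiff, sumConnector, sumConnector, prod_range_succ, prod_range_succ _ (i + 1)]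
  rw [show j + (i + 1) + 1 = j + i + 2 by ring]
  ring

/-- The connector and its two shifts are one common kernel times `j + i + 2 - X`, `j + 1 - X` and `i
+ 1 - X`. In a difference `X` cancels and an integer remains; this drives both telescopings. -/
theorem sumConnector_sub_left (j i : ℕ) :
    sumConnector j i - sumConnector (j + 1) i = ((i + 1 : ℕ) : ℝ⟦X⟧) * sumConnectorDiff j i := by
  rw [sumConnector_eq, sumConnector_succ_left]
  push_cast
  ring

theorem sumConnector_sub_right (j i : ℕ) :
    sumConnector j i - sumConnector j (i + 1) = ((j + 1 : ℕ) : ℝ⟦X⟧) * sumConnectorDiff j i := by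
  rw [sumConnector_eq, sumConnector_succ_right]
  push_cast
  ring

theorem sumConnector_mul_invSubX (j i : ℕ) :
    sumConnector j (i + 1) * invSubX (i + 1) = sumConnectorDiff j i := by
  have h := sub_X_mul_invSubX (k := i + 1) (by omega)
  rw [sumConnector_succ_right]
  linear_combination sumConnectorDiff j i * h

theorem sumConnector_zero_right (j : ℕ) : sumConnector j 0 = invSubX (j + 1) := by
  simp [sumConnector]

theorem sumConnector_zero_left (i : ℕ) : sumConnector 0 i = invSubX (i + 1) := by
  induction i with
  | zero => simp [sumConnector]
  | succ i ih =>
    have h := sub_X_mul_invSubX (k := i + 1) (by omega)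
    rw [sumConnector_succ_right, sumConnectorDiff, ih, zero_add]
    linear_combination invSubX (i + 2) * h

theorem C_one_div_mul_natCast {k : ℕ} (hk : k ≠ 0) : C (1 / (k : ℝ)) * (k : ℝ⟦X⟧) = 1 := by
  have hC : (k : ℝ⟦X⟧) = C (k : ℝ) := by simp
  have : (k : ℝ) ≠ 0 := by exact_mod_cast hk
  rw [hC, ← map_mul, one_div_mul_cancel this, map_one]

/-- The factor `k - X` has majorant ratio `1 / k`, and the inverse factors have comparable ratios.
The ratios add up to harmonic sums, while the constant terms give the decay in both indices. -/
theorem coeffBound_sumConnector (j i : ℕ) :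
    CoeffBound (sumConnector j i) (1 / ((i + 1) * (j + 1))) (2 * harmonicSum (i + 2)) := by
  suffices h : CoeffBound (sumConnector j i) (1 / ((i + 1) * (j + 1)))
      (harmonicSum (i + 1) + harmonicSum (i + 2)) by
    have h1 : harmonicSum (i + 1) ≤ harmonicSum (i + 2) := harmonicSum_mono (by omega)
    exact h.mono (add_nonneg (harmonicSum_nonneg _) (harmonicSum_nonneg _)) le_rfl (by linarith)
  induction i with
  | zero =>
    rw [sumConnector_zero_right]
    have h := coeffBound_invSubX (p := 1) (k := j + 1) one_ne_zero (by omega)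
    refine h.mono (by norm_num) (by simp) ?_
    simp [harmonicSum, sum_range_succ]
  | succ i ih =>
    have h1 : CoeffBound (((i + 1 : ℕ) : ℝ⟦X⟧) - X) (i + 1) (1 / ((i + 1 : ℕ) : ℝ)) := by
      have hC : ((i + 1 : ℕ) : ℝ⟦X⟧) = C ((i + 1 : ℕ) : ℝ) := by simp
      intro n
      rw [hC]
      rcases n with _ | _ | n
      · rw [map_sub, coeff_C, coeff_X, if_pos rfl, if_neg (by omega), sub_zero,
          abs_of_nonneg (by positivity)]
        simp
      · have : (i + 1 : ℝ) ≠ 0 := by positivity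
        rw [map_sub, coeff_C, coeff_X, if_neg (by omega), if_pos rfl]
        simp [this]
      · rw [map_sub, coeff_C, coeff_X, if_neg (by omega), if_neg (by omega)]
        simp
        positivity
    have h2 := coeffBound_invSubX (p := i + 2) (k := j + i + 2) (by omega) (by omega)
    have h := ih.mul (h1.mul h2 (by positivity) (by positivity))
      (add_nonneg (harmonicSum_nonneg _) (harmonicSum_nonneg _)) (by positivity)
    rw [sumConnector_succ_right, sumConnectorDiff, mul_assoc, mul_comm (invSubX _)]
    refine h.mono (add_nonneg (add_nonneg (harmonicSum_nonneg _) (harmonicSum_nonneg _))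
      (by positivity)) ?_ (le_of_eq ?_)
    · push_cast
      rw [mul_one_div, div_mul_div_comm, one_mul, mul_right_comm, mul_assoc, mul_comm ((i : ℝ) + 1),
        div_mul_cancel_right₀ (by positivity), ← one_div]
      refine one_div_le_one_div_of_le (by positivity) ?_
      nlinarith [(Nat.cast_nonneg i : (0 : ℝ) ≤ i), (Nat.cast_nonneg j : (0 : ℝ) ≤ j)]
    · rw [harmonicSum_succ (i + 2), harmonicSum_succ (i + 1)]
      ring

theorem succ_mul_sum_sumConnectorDiff_zero (j I : ℕ) :
    ((j + 1 : ℕ) : ℝ⟦X⟧) * ∑ i ∈ range I, sumConnectorDiff j i * esymmInv 0 (i + 1) =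
      invSubX (j + 1) - sumConnector j I := by
  simp only [esymmInv_zero, mul_one, mul_sum, ← sumConnector_sub_right]
  rw [sum_range_sub', sumConnector_zero_right]

/-- Summation by parts in `i`: the increment of `esymmInv (n + 1)` carries a factor `1 / (i + 1 -
X)` that turns the shifted connector back into the difference kernel. The depth drops by one at the
price of a boundary term at `I`. -/
theorem succ_mul_sum_sumConnectorDiff_succ (n j I : ℕ) :
    ((j + 1 : ℕ) : ℝ⟦X⟧) * ∑ i ∈ range I, sumConnectorDiff j i * esymmInv (n + 1) (i + 1) =
      ∑ i ∈ range I, sumConnectorDiff j i * esymmInv n (i + 1)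
        - sumConnector j I * esymmInv (n + 1) (I + 1) := by
  have h (i : ℕ) : ((j + 1 : ℕ) : ℝ⟦X⟧) * (sumConnectorDiff j i * esymmInv (n + 1) (i + 1)) =
      (sumConnector j i * esymmInv (n + 1) (i + 1)
        - sumConnector j (i + 1) * esymmInv (n + 1) (i + 1 + 1))
      + sumConnectorDiff j i * esymmInv n (i + 1) := by
    rw [← mul_assoc, ← sumConnector_sub_right, esymmInv_succ_succ n (i + 1),
      ← sumConnector_mul_invSubX]
    ring
  rw [mul_sum]
  simp only [h, sum_add_distrib]
  rw [sum_range_sub' (fun i => sumConnector j i * esymmInv (n + 1) (i + 1))]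
  simp [esymmInv_succ, invSubX_zero]
  ring

/-- Each reduction of the depth contributes `1 / (j + 1)` to the main term, and the boundary terms
accumulate in the error. -/
theorem coeffBound_sum_sumConnectorDiff (n j I : ℕ) :
    CoeffBound (∑ i ∈ range I, sumConnectorDiff j i * esymmInv n (i + 1)
        - C (1 / ((j : ℝ) + 1) ^ (n + 1)) * invSubX (j + 1))
      ((n + 1) * harmonicSum (I + 2) ^ n / ((j + 1) ^ 2 * (I + 1)))
      (2 * harmonicSum (I + 2) + n) := by
  have hj : C (1 / ((j : ℝ) + 1)) * ((j + 1 : ℕ) : ℝ⟦X⟧) = 1 := by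
    simpa using C_one_div_mul_natCast (k := j + 1) (by omega)
  have hH := harmonicSum_nonneg (I + 2)
  have hH1 := one_le_harmonicSum (m := I + 2) (by omega)
  have hc := coeffBound_sumConnector j I
  induction n with
  | zero =>
    have h0 := succ_mul_sum_sumConnectorDiff_zero j I
    have : ∑ i ∈ range I, sumConnectorDiff j i * esymmInv 0 (i + 1)
        - C (1 / ((j : ℝ) + 1) ^ (0 + 1)) * invSubX (j + 1) =
        -(C (1 / ((j : ℝ) + 1)) * sumConnector j I) := by
      rw [zero_add, pow_one]
      linear_combination C (1 / ((j : ℝ) + 1)) * h0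
        - (∑ i ∈ range I, sumConnectorDiff j i * esymmInv 0 (i + 1)) * hj
    rw [this]
    refine (hc.C_mul (by positivity)).neg.mono (by positivity) (le_of_eq ?_) (by simp)
    field_simp
    simp
  | succ n ih =>
    have h0 := succ_mul_sum_sumConnectorDiff_succ n j I
    have : ∑ i ∈ range I, sumConnectorDiff j i * esymmInv (n + 1) (i + 1)
        - C (1 / ((j : ℝ) + 1) ^ (n + 1 + 1)) * invSubX (j + 1) =
        C (1 / ((j : ℝ) + 1)) * ((∑ i ∈ range I, sumConnectorDiff j i * esymmInv n (i + 1)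
          - C (1 / ((j : ℝ) + 1) ^ (n + 1)) * invSubX (j + 1))
          - sumConnector j I * esymmInv (n + 1) (I + 1)) := by
      rw [pow_succ, ← one_div_mul_one_div, map_mul]
      linear_combination C (1 / ((j : ℝ) + 1)) * h0
        - (∑ i ∈ range I, sumConnectorDiff j i * esymmInv (n + 1) (i + 1)) * hj
    rw [this]
    have h1 := hc.mul (coeffBound_esymmInv (n + 1) (I + 1)) (by positivity) (by positivity)
    have hH2 : harmonicSum (I + 1) ≤ harmonicSum (I + 2) := harmonicSum_mono (by omega)
    have hH3 := harmonicSum_nonneg (I + 1)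
    push_cast at h1 ⊢
    refine (((ih.mono (by positivity) le_rfl (by linarith)).sub h1).C_mul
      (by positivity)).mono (by positivity) ?_ le_rfl
    have e1 : harmonicSum (I + 1) ^ (n + 1) ≤ harmonicSum (I + 2) ^ (n + 1) := by gcongr
    have e2 : harmonicSum (I + 2) ^ n ≤ harmonicSum (I + 2) ^ (n + 1) :=
      pow_le_pow_right₀ hH1 (by omega)
    have e3 : 1 / ((j : ℝ) + 1) ≤ 1 := by
      rw [div_le_one (by positivity)]
      linarith [(Nat.cast_nonneg j : (0 : ℝ) ≤ j)]
    set A := harmonicSum (I + 2) ^ (n + 1)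
    calc 1 / ((j : ℝ) + 1) * ((n + 1) * harmonicSum (I + 2) ^ n / ((j + 1) ^ 2 * (I + 1))
          + 1 / ((I + 1) * (j + 1)) * harmonicSum (I + 1) ^ (n + 1))
        ≤ 1 / ((j : ℝ) + 1) * ((n + 1) * A / ((j + 1) ^ 2 * (I + 1))
          + 1 / ((I + 1) * (j + 1)) * A) := by gcongr
      _ = 1 / ((j : ℝ) + 1) * ((n + 1) * A / ((j + 1) ^ 2 * (I + 1)))
          + A / ((j + 1) ^ 2 * (I + 1)) := by field_simp
      _ ≤ 1 * ((n + 1) * A / ((j + 1) ^ 2 * (I + 1))) + A / ((j + 1) ^ 2 * (I + 1)) := by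
          gcongr
      _ = (n + 1 + 1) * A / ((j + 1) ^ 2 * (I + 1)) := by ring

/-- Telescoping in `j`: the weight `1 / (i + 1)` cancels the integer in `sumConnector_sub_left`. -/
theorem sum_sumConnector_eq (n I J : ℕ) :
    ∑ i ∈ range I, C (1 / ((i : ℝ) + 1)) * sumConnector 0 i * esymmInv n (i + 1) =
      ∑ j ∈ range J, ∑ i ∈ range I, sumConnectorDiff j i * esymmInv n (i + 1)
      + ∑ i ∈ range I, C (1 / ((i : ℝ) + 1)) * sumConnector J i * esymmInv n (i + 1) := by
  induction J with
  | zero => simp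
  | succ J ih =>
    rw [ih, sum_range_succ, add_assoc, ← sum_add_distrib, add_right_inj]
    refine sum_congr rfl fun i _ => ?_
    have hi : C (1 / ((i : ℝ) + 1)) * ((i + 1 : ℕ) : ℝ⟦X⟧) = 1 := by
      simpa using C_one_div_mul_natCast (k := i + 1) (by omega)
    have h := sumConnector_sub_left J i
    linear_combination C (1 / ((i : ℝ) + 1)) * esymmInv n (i + 1) * h
      + sumConnectorDiff J i * esymmInv n (i + 1) * hi

theorem coeffBound_sum_formula (n I : ℕ) :
    CoeffBound (∑ i ∈ range I, C (1 / ((i : ℝ) + 1)) * sumConnector 0 i * esymmInv n (i + 1)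
        - ∑ j ∈ range I, C (1 / ((j : ℝ) + 1) ^ (n + 1)) * invSubX (j + 1))
      ((2 * n + 4) * harmonicSum (I + 2) ^ n / (I + 1)) (2 * harmonicSum (I + 2) + n) := by
  have hH := harmonicSum_nonneg (I + 2)
  have h1 := CoeffBound.sum fun j (_ : j ∈ range I) => coeffBound_sum_sumConnectorDiff n j I
  have h2 : CoeffBound (∑ i ∈ range I, C (1 / ((i : ℝ) + 1)) * sumConnector I i *
      esymmInv n (i + 1)) (∑ i ∈ range I, harmonicSum (I + 2) ^ n / ((i + 1) ^ 2 * (I + 1)))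
      (2 * harmonicSum (I + 2) + n) := by
    refine CoeffBound.sum fun i hi => ?_
    have hi' : i < I := mem_range.1 hi
    have e1 : harmonicSum (i + 1) ≤ harmonicSum (I + 2) := harmonicSum_mono (by omega)
    have e2 : harmonicSum (i + 2) ≤ harmonicSum (I + 2) := harmonicSum_mono (by omega)
    have e3 := harmonicSum_nonneg (i + 1)
    have e4 := harmonicSum_nonneg (i + 2)
    refine ((((coeffBound_sumConnector I i).C_mul (x := 1 / ((i : ℝ) + 1)) (by positivity)).mul
      (coeffBound_esymmInv n (i + 1)) (by positivity) (by positivity)).mono (by positivity)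
      ?_ (by gcongr))
    calc 1 / ((i : ℝ) + 1) * (1 / ((i + 1) * (I + 1))) * harmonicSum (i + 1) ^ n
        ≤ 1 / ((i : ℝ) + 1) * (1 / ((i + 1) * (I + 1))) * harmonicSum (I + 2) ^ n := by gcongr
      _ = _ := by field_simp
  have h := h1.add h2
  -- With `J = I` both the summation-by-parts errors and the remainder at `J` are of order `1 / I`
  -- up to powers of harmonic sums.
  rw [sum_sumConnector_eq n I I, add_sub_right_comm, ← sum_sub_distrib]
  refine h.mono (by positivity) ?_ le_rfl
  have hs := sum_one_div_succ_sq_le I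
  have e1 : ∑ j ∈ range I, ((n : ℝ) + 1) * harmonicSum (I + 2) ^ n / ((j + 1) ^ 2 * (I + 1)) =
      ((n : ℝ) + 1) * harmonicSum (I + 2) ^ n / (I + 1) *
        ∑ j ∈ range I, 1 / ((j : ℝ) + 1) ^ 2 := by
    rw [mul_sum]
    exact sum_congr rfl fun j _ => by field_simp
  have e2 : ∑ j ∈ range I, harmonicSum (I + 2) ^ n / (((j : ℝ) + 1) ^ 2 * (I + 1)) =
      harmonicSum (I + 2) ^ n / (I + 1) * ∑ j ∈ range I, 1 / ((j : ℝ) + 1) ^ 2 := by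
    rw [mul_sum]
    exact sum_congr rfl fun j _ => by field_simp
  rw [e1, e2, ← add_mul]
  calc _ ≤ (((n : ℝ) + 1) * harmonicSum (I + 2) ^ n / (I + 1)
        + harmonicSum (I + 2) ^ n / (I + 1)) * 2 := by gcongr
    _ = _ := by ring

/-- The elementary symmetric function with its outermost factor replaced by `1 / k`. -/
noncomputable def esymmInvOuterZero (n M : ℕ) : ℝ⟦X⟧ :=
  ∑ k ∈ range M, C (1 / (k : ℝ)) * esymmInv n k

theorem invSubX_sub_C (k : ℕ) : invSubX k - C (1 / (k : ℝ)) = X * (C (1 / (k : ℝ)) * invSubX k) := by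
  ext n
  cases n with
  | zero => rw [map_sub, coeff_invSubX, coeff_C, if_pos rfl, coeff_zero_X_mul]; simp
  | succ n =>
    rw [coeff_succ_X_mul, coeff_C_mul, map_sub, coeff_invSubX, coeff_invSubX, coeff_C]
    simp
    ring

theorem esymmInv_succ_sub_esymmInvOuterZero (n I : ℕ) :
    esymmInv (n + 1) (I + 1) - esymmInvOuterZero n (I + 1) =
      X * ∑ i ∈ range I, C (1 / ((i : ℝ) + 1)) * sumConnector 0 i * esymmInv n (i + 1) := by
  rw [esymmInv_succ, esymmInvOuterZero, ← sum_sub_distrib, sum_range_succ']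
  simp only [← sub_mul, invSubX_sub_C, sumConnector_zero_left, mul_assoc, ← mul_sum]
  simp

/-- The sum formula for multiple zeta values, for truncated sums up to a vanishing error. -/
theorem tendsto_coeff_esymmInv_sub (n N : ℕ) :
    Tendsto (fun M => coeff (N + 1) (esymmInv (n + 1) M - esymmInvOuterZero n M)
      - ∑ k ∈ range M, 1 / (k : ℝ) ^ (N + n + 2)) atTop (𝓝 0) := by
  rw [← tendsto_add_atTop_iff_nat 1]
  have hlim := ((tendsto_harmonicSum_pow_div (n + N)).comp (tendsto_add_atTop_nat 1)).const_mul
    ((2 * n + 4) * (2 + n : ℝ) ^ N)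
  rw [mul_zero] at hlim
  refine squeeze_zero_norm (fun I => ?_) hlim
  have hb := coeffBound_sum_formula n I N
  have hH1 := one_le_harmonicSum (m := I + 2) (by omega)
  rw [esymmInv_succ_sub_esymmInvOuterZero, coeff_succ_X_mul, Real.norm_eq_abs]
  have he : ∑ k ∈ range (I + 1), 1 / (k : ℝ) ^ (N + n + 2) =
      coeff N (∑ j ∈ range I, C (1 / ((j : ℝ) + 1) ^ (n + 1)) * invSubX (j + 1)) := by
    rw [sum_range_succ', map_sum]
    simp only [coeff_C_mul, coeff_invSubX]
    simp
    refine sum_congr rfl fun j _ => ?_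
    rw [← mul_inv, ← pow_add]
    congr 2
    ring
  rw [he, ← map_sub]
  refine hb.trans ?_
  have : (2 * harmonicSum (I + 2) + n) ≤ (2 + n) * harmonicSum (I + 2) := by
    nlinarith [(Nat.cast_nonneg n : (0 : ℝ) ≤ n)]
  have h0 := harmonicSum_nonneg (I + 2)
  calc (2 * n + 4) * harmonicSum (I + 2) ^ n / (I + 1) * (2 * harmonicSum (I + 2) + n) ^ N
      ≤ (2 * n + 4) * harmonicSum (I + 2) ^ n / (I + 1) * ((2 + n) * harmonicSum (I + 2)) ^ N := by
        gcongr
    _ = _ := by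
        simp only [Function.comp, mul_pow, pow_add]
        push_cast
        ring

/-! ### Asymptotics of the corner sums -/

/-- For given `p` at most `p` values of `q` lie in the corner, so one power of `p` is lost. -/
theorem sum_corner_one_div_sq_le (M : ℕ) :
    ∑ s ∈ corner M, 1 / (s.1 : ℝ) ^ 2 ≤ harmonicSum M := by
  rw [corner, sum_filter, sum_product, harmonicSum]
  refine sum_le_sum fun p hp => ?_
  dsimp only
  rw [← sum_filter, sum_const, nsmul_eq_mul]
  have hcard : #{q ∈ range M | M ≤ p + q} ≤ p := by
    calc #{q ∈ range M | M ≤ p + q} ≤ #(Ico (M - p) M) := by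
          refine card_le_card fun q hq => ?_
          simp at hq ⊢
          omega
      _ ≤ p := by simp; omega
  rcases eq_or_ne p 0 with rfl | h
  · simp
  have hp' : (0 : ℝ) < p := by exact_mod_cast Nat.pos_of_ne_zero h
  calc ((#{q ∈ range M | M ≤ p + q} : ℕ) : ℝ) * (1 / (p : ℝ) ^ 2) ≤ p * (1 / (p : ℝ) ^ 2) := by
        gcongr
    _ = 1 / (p : ℝ) := by field_simp

theorem tendsto_sum_corner {f : ℕ → ℕ → ℕ → ℝ} {K : ℝ} {b : ℕ}
    (hsymm : ∀ M p q, f M p q = f M q p)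
    (hf : ∀ M p q, p ≠ 0 → p ≤ q → q < M →
      |f M p q| ≤ K * harmonicSum (M + 1) ^ b / ((p : ℝ) ^ 2 * q)) :
    Tendsto (fun M => ∑ s ∈ corner M, f M s.1 s.2) atTop (𝓝 0) := by
  have hlim := (tendsto_harmonicSum_pow_div (b + 1)).const_mul (4 * |K|)
  rw [mul_zero] at hlim
  refine squeeze_zero_norm (fun M => ?_) hlim
  have hH := harmonicSum_nonneg (M + 1)
  have key : ∀ p q, p ≤ q → q < M → M ≤ p + q →
      |f M p q| ≤ 2 * |K| * harmonicSum (M + 1) ^ b / M * (1 / (p : ℝ) ^ 2 + 1 / (q : ℝ) ^ 2) := by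
    intro p q hpq hq hM
    have hp : p ≠ 0 := by omega
    have hp' : (0 : ℝ) < p := by exact_mod_cast Nat.pos_of_ne_zero hp
    have hq' : (0 : ℝ) < q := by exact_mod_cast (by omega : 0 < q)
    have hM' : (0 : ℝ) < M := by exact_mod_cast (by omega : 0 < M)
    -- In the corner the larger index is at least `M / 2`; this is the source of the factor `1 / M`.
    have h2 : (M : ℝ) ≤ 2 * q := by exact_mod_cast (by omega : M ≤ 2 * q)
    refine (hf M p q hp hpq hq).trans ?_
    calc K * harmonicSum (M + 1) ^ b / ((p : ℝ) ^ 2 * q)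
        ≤ |K| * harmonicSum (M + 1) ^ b / ((p : ℝ) ^ 2 * q) := by
          gcongr
          exact le_abs_self K
      _ ≤ |K| * harmonicSum (M + 1) ^ b / ((p : ℝ) ^ 2 * (M / 2)) := by
          gcongr
          linarith
      _ = 2 * |K| * harmonicSum (M + 1) ^ b / M * (1 / (p : ℝ) ^ 2 + 0) := by
          field_simp
          ring
      _ ≤ _ := by
          gcongr
          positivity
  calc ‖∑ s ∈ corner M, f M s.1 s.2‖
      ≤ ∑ s ∈ corner M, 2 * |K| * harmonicSum (M + 1) ^ b / M *
          (1 / (s.1 : ℝ) ^ 2 + 1 / (s.2 : ℝ) ^ 2) := by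
        refine norm_sum_le_of_le _ fun s hs => ?_
        obtain ⟨h1, h2, h3⟩ := mem_corner.1 hs
        rw [Real.norm_eq_abs]
        rcases le_total s.1 s.2 with h | h
        · exact key _ _ h h2 h3
        · rw [hsymm, add_comm (1 / (s.1 : ℝ) ^ 2)]
          exact key _ _ h h1 (by omega)
    _ ≤ 2 * |K| * harmonicSum (M + 1) ^ b / M * (harmonicSum (M + 1) + harmonicSum (M + 1)) := by
        rw [← mul_sum, sum_add_distrib,
          ← sum_corner_swap fun p _ => 1 / (p : ℝ) ^ 2]
        have h := (sum_corner_one_div_sq_le M).trans (harmonicSum_mono (Nat.le_succ M))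
        gcongr
    _ = 4 * |K| * (harmonicSum (M + 1) ^ (b + 1) / M) := by ring

/-- In positive degree the ratio `r / p` supplies an extra `1 / p`. The constant coefficient has no
such gain, which is why only degrees `N + 1` are considered. -/
theorem CoeffBound.abs_coeff_succ_le {f : ℝ⟦X⟧} {c r : ℝ} {p q : ℕ} (hp : p ≠ 0)
    (hc : 0 ≤ c) (hr : 0 ≤ r) (h : CoeffBound f (c / (p * q)) (r / p)) (N : ℕ) :
    |coeff (N + 1) f| ≤ c * r ^ (N + 1) / ((p : ℝ) ^ 2 * q) := by
  have hp' : (1 : ℝ) ≤ p := by exact_mod_cast Nat.pos_of_ne_zero hp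
  refine (h (N + 1)).trans ?_
  have h1 : (p : ℝ) ≤ p ^ (N + 1) := le_self_pow₀ hp' (by omega)
  calc c / (p * q) * (r / p) ^ (N + 1) = c * r ^ (N + 1) / (p * q) / p ^ (N + 1) := by
        rw [div_pow]; ring
    _ ≤ c * r ^ (N + 1) / (p * q) / p := by gcongr
    _ = _ := by
        rw [div_div]
        congr 1
        ring

/-- Only terms with `p ≤ k < q` remain in the difference, so the ratio is `1 / p` rather than `1`.
-/
theorem coeffBound_esymmInv_one_sub {p q M : ℕ} (hp : p ≠ 0) (hpq : p ≤ q) (hq : q < M) :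
    CoeffBound (esymmInv 1 p - esymmInv 1 q) (harmonicSum (M + 1)) (1 / p) := by
  rw [esymmInv_one_eq_sum, esymmInv_one_eq_sum, ← neg_sub, ← sum_Ico_eq_sub _ hpq]
  have h : CoeffBound (∑ k ∈ Ico p q, invSubX k) (∑ k ∈ Ico p q, 1 / (k : ℝ)) (1 / p) :=
    CoeffBound.sum fun k hk => coeffBound_invSubX hp (mem_Ico.1 hk).1
  refine h.neg.mono (by positivity) ?_ le_rfl
  refine sum_le_sum_of_subset_of_nonneg (fun k hk => ?_) fun _ _ _ => by positivity
  simp at hk ⊢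
  omega

theorem coeffBound_invSubX_mul {p q : ℕ} (hp : p ≠ 0) (hpq : p ≤ q) :
    CoeffBound (invSubX p * invSubX q) (1 / p * (1 / q)) (1 / p + 1 / p) :=
  (coeffBound_invSubX hp le_rfl).mul (coeffBound_invSubX hp hpq) (by positivity) (by positivity)

theorem abs_coeff_cornerKernelTotal_le {M p q : ℕ} (hp : p ≠ 0) (hpq : p ≤ q) (hq : q < M)
    (N : ℕ) : |coeff (N + 1) (cornerKernelTotal p q)| ≤
      5 * 4 ^ (N + 1) * harmonicSum (M + 1) ^ 2 / ((p : ℝ) ^ 2 * q) := by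
  have hp' : (1 : ℝ) ≤ p := by exact_mod_cast Nat.pos_of_ne_zero hp
  have hq' : (1 : ℝ) ≤ q := hp'.trans (by exact_mod_cast hpq)
  have hip : 1 / (p : ℝ) ≤ 1 := by rw [div_le_one (by positivity)]; exact hp'
  have hiq : 1 / (q : ℝ) ≤ 1 := by rw [div_le_one (by positivity)]; exact hq'
  have hH := one_le_harmonicSum (m := M + 1) (by omega)
  have h1 := coeffBound_esymmInv_one_sub hp hpq hq
  have h2 := ((coeffBound_invSubX hp le_rfl).mono (by positivity) hip le_rfl)
  have h3 := ((coeffBound_invSubX hp hpq).mono (by positivity) hiq le_rfl)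
  have r0 : (0 : ℝ) ≤ 1 / p := by positivity
  have h4 := (((h1.mul h1 r0 r0).add ((h2.sub h3).mul h1 r0 r0)).add
    ((((h2.mul h2 r0 r0).add (h3.mul h3 r0 r0)).sub (h2.mul h3 r0 r0)).C_mul
      (x := 1 / 2) (by norm_num)))
  have h5 := ((coeffBound_invSubX_mul hp hpq).mul h4 (by positivity) (by positivity)).C_mul
    (x := 1 / 4) (by norm_num)
  have h6 : CoeffBound (cornerKernelTotal p q) (5 * harmonicSum (M + 1) ^ 2 / (p * q)) (4 / p) := by
    simp only [← sq] at h5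
    refine h5.mono (by positivity) ?_ (le_of_eq (by ring))
    have hY : harmonicSum (M + 1) ^ 2 + (1 + 1) * harmonicSum (M + 1)
        + 1 / 2 * (1 ^ 2 + 1 ^ 2 + 1 ^ 2) ≤ 5 * harmonicSum (M + 1) ^ 2 := by nlinarith
    rw [one_div_mul_one_div]
    calc _ ≤ 1 * (1 / ((p : ℝ) * q) * (5 * harmonicSum (M + 1) ^ 2)) := by
          gcongr
          norm_num
      _ = _ := by ring
  refine (h6.abs_coeff_succ_le hp (by positivity) (by norm_num) N).trans (le_of_eq (by ring))

theorem cornerKernelTotal_comm (p q : ℕ) : cornerKernelTotal p q = cornerKernelTotal q p := by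
  rw [cornerKernelTotal, cornerKernelTotal]; ring

theorem cornerKernelThree_comm (p q : ℕ) : cornerKernelThree p q = cornerKernelThree q p := by
  rw [cornerKernelThree, cornerKernelThree]; ring

theorem tendsto_coeff_sum_cornerKernelTotal (N : ℕ) :
    Tendsto (fun M => coeff (N + 1) (∑ s ∈ corner M, cornerKernelTotal s.1 s.2)) atTop (𝓝 0) := by
  simp only [map_sum]
  exact tendsto_sum_corner (f := fun _ p q => coeff (N + 1) (cornerKernelTotal p q))
    (fun _ p q => by rw [cornerKernelTotal_comm])
    fun M p q hp hpq hq => abs_coeff_cornerKernelTotal_le hp hpq hq N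

theorem coeffBound_invSubX_sq (k : ℕ) : CoeffBound (invSubX k ^ 2) (1 / (k : ℝ) ^ 2) 2 := by
  have h := (coeffBound_invSubX_one k).mul (coeffBound_invSubX_one k) zero_le_one zero_le_one
  rw [← sq] at h
  refine h.mono (by norm_num) (le_of_eq ?_) (by norm_num)
  rw [one_div_mul_one_div, ← sq]

theorem coeffBound_psumInv_two_sub {p M : ℕ} (hp : p ≠ 0) (hpM : p ≤ M) :
    CoeffBound (psumInv 2 M - psumInv 2 p) (2 / p) 2 := by
  rw [psumInv, psumInv, ← sum_Ico_eq_sub _ hpM]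
  refine (CoeffBound.sum fun k _ => coeffBound_invSubX_sq k).mono (by norm_num) ?_ le_rfl
  have h := sum_Ioo_inv_sq_le (α := ℝ) (p - 1) M
  have h1 : ((p - 1 : ℕ) : ℝ) + 1 = p := by
    exact_mod_cast Nat.sub_add_cancel (Nat.one_le_iff_ne_zero.2 hp)
  rw [h1, show Ioo (p - 1) M = Ico p M by ext; simp; omega] at h
  simpa using h

theorem coeffBound_psumInv_two (m : ℕ) : CoeffBound (psumInv 2 m) 2 2 := by
  rcases Nat.eq_zero_or_pos m with rfl | hm
  · intro n; simp [psumInv]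
  · have h := coeffBound_psumInv_two_sub one_ne_zero hm
    have h1 : psumInv 2 1 = 0 := by simp [psumInv, invSubX_zero]
    simpa [h1] using h

theorem coeffBound_invSubX_mul_sub {p q : ℕ} (hp : p ≠ 0) (hpq : p ≤ q) :
    CoeffBound (invSubX p * invSubX q - C (1 / p * (1 / q) : ℝ)) (1 / ((p : ℝ) ^ 2 * q)) 2 := by
  intro n
  cases n with
  | zero =>
    rw [map_sub, coeff_C, if_pos rfl, coeff_zero_eq_constantCoeff, map_mul, ← coeff_zero_eq_constantCoeff,
      coeff_invSubX, coeff_invSubX]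
    simp
    positivity
  | succ n =>
    rw [map_sub, coeff_C, if_neg (by omega), sub_zero]
    have h : CoeffBound (invSubX p * invSubX q) (1 / (p * q)) (2 / p) := by
      refine (coeffBound_invSubX_mul hp hpq).mono (by positivity) (le_of_eq ?_) (le_of_eq ?_)
      · rw [one_div_mul_one_div]
      · ring
    refine (h.abs_coeff_succ_le hp zero_le_one zero_le_two n).trans (le_of_eq (by ring))

/-- The squared difference in the kernel decays, but the `psumInv 2` part does not. Replacing its
prefactor by the constant `1 / (p q)` and both arguments by `M` costs terms of order `1 / (p² q)`,
and what is left is the correction added here. -/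
theorem abs_coeff_cornerKernelThree_add_le {M p q : ℕ} (hp : p ≠ 0) (hpq : p ≤ q) (hq : q < M)
    (N : ℕ) : |coeff (N + 1) (cornerKernelThree p q
        + C (1 / p * (1 / q) : ℝ) * (C (1 / 2) * psumInv 2 M))| ≤
      3 * 4 ^ (N + 1) * harmonicSum (M + 1) ^ 2 / ((p : ℝ) ^ 2 * q) := by
  have hp' : (1 : ℝ) ≤ p := by exact_mod_cast Nat.pos_of_ne_zero hp
  have hpq' : (p : ℝ) ≤ q := by exact_mod_cast hpq
  have hq' : (1 : ℝ) ≤ q := hp'.trans hpq'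
  have hH := one_le_harmonicSum (m := M + 1) (by omega)
  have h1 := coeffBound_esymmInv_one_sub hp hpq hq
  have r0 : (0 : ℝ) ≤ 1 / p := by positivity
  have hsq := ((coeffBound_invSubX_mul hp hpq).mul (h1.mul h1 r0 r0) (by positivity)
    (by positivity)).C_mul (x := 1 / 4) (by norm_num)
  have hsq' : CoeffBound (C (1 / 4) * (invSubX p * invSubX q *
      (esymmInv 1 p - esymmInv 1 q) ^ 2)) (harmonicSum (M + 1) ^ 2 / (p * q)) (4 / p) := by
    simp only [← sq] at hsq
    refine hsq.mono (by positivity) ?_ (le_of_eq (by ring))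
    rw [one_div_mul_one_div, ← mul_assoc, mul_comm, ← mul_assoc, mul_one_div]
    gcongr
    nlinarith
  have hA := hsq'.abs_coeff_succ_le hp (by positivity) (by norm_num) N
  have h2 := ((coeffBound_invSubX_mul_sub hp hpq).mul
    ((coeffBound_psumInv_two p).add (coeffBound_psumInv_two q)) zero_le_two zero_le_two).neg
  have hPq := (coeffBound_psumInv_two_sub (p := q) (M := M) (by omega) hq.le).mono
    zero_le_two (d := 2 / (p : ℝ)) (by gcongr) le_rfl
  have h3 := ((coeffBound_psumInv_two_sub hp (hpq.trans hq.le)).add hPq).C_mul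
    (x := 1 / (p : ℝ) * (1 / q)) (by positivity)
  have h4 := (h2.add (h3.mono (s := 2 + 2) zero_le_two le_rfl (by norm_num))).C_mul
    (x := 1 / 4) (by norm_num)
  have hB := h4 (N + 1)
  have hc : C (1 / 2 : ℝ) = 2 * C (1 / 4) := by
    rw [← map_ofNat (C (R := ℝ)) 2, ← map_mul]; norm_num
  have hsplit : cornerKernelThree p q + C (1 / p * (1 / q) : ℝ) * (C (1 / 2) * psumInv 2 M) =
      C (1 / 4) * (invSubX p * invSubX q * (esymmInv 1 p - esymmInv 1 q) ^ 2)
      + C (1 / 4) * (-((invSubX p * invSubX q - C (1 / p * (1 / q) : ℝ)) *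
          (psumInv 2 p + psumInv 2 q))
        + C (1 / p * (1 / q) : ℝ) * (psumInv 2 M - psumInv 2 p + (psumInv 2 M - psumInv 2 q))) := by
    rw [cornerKernelThree, hc]
    ring
  rw [hsplit, map_add]
  refine (abs_add_le _ _).trans ((add_le_add hA hB).trans ?_)
  have e : 1 / 4 * (1 / ((p : ℝ) ^ 2 * q) * (2 + 2) + 1 / p * (1 / q) * (2 / p + 2 / p)) *
      (2 + 2) ^ (N + 1) = 2 * 4 ^ (N + 1) * 1 / ((p : ℝ) ^ 2 * q) := by
    field_simp
    norm_num
  rw [e]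
  have hH2 : 1 ≤ harmonicSum (M + 1) ^ 2 := one_le_pow₀ hH
  calc _ ≤ harmonicSum (M + 1) ^ 2 * 4 ^ (N + 1) / ((p : ℝ) ^ 2 * q)
        + 2 * 4 ^ (N + 1) * harmonicSum (M + 1) ^ 2 / ((p : ℝ) ^ 2 * q) := by gcongr
    _ = _ := by ring

/-- The square gives `H(M)²` and each antidiagonal `2 H(m) / m`, where `H` is `harmonicSum`.
Expanding `H(M)²` into diagonal and off-diagonal terms leaves the diagonal. -/
theorem sum_corner_one_div_mul (M : ℕ) :
    ∑ s ∈ corner M, 1 / (s.1 : ℝ) * (1 / s.2) = ∑ k ∈ range M, 1 / (k : ℝ) ^ 2 := by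
  have h := sum_antidiagonal_add_sum_corner (fun p q => 1 / (p : ℝ) * (1 / q)) M
  have hdiag (m : ℕ) : ∑ s ∈ antidiagonal m, 1 / (s.1 : ℝ) * (1 / s.2) =
      2 * (1 / m * harmonicSum m) := by
    rcases eq_or_ne m 0 with rfl | hm
    · simp
    have hm' : (m : ℝ) ≠ 0 := by exact_mod_cast hm
    have key (s : ℕ × ℕ) (hs : s ∈ antidiagonal m) : 1 / (s.1 : ℝ) * (1 / s.2) =
        1 / m * ((if s.1 = 0 then 0 else 1) * (1 / (s.2 : ℝ)))
        + 1 / m * ((if s.2 = 0 then 0 else 1) * (1 / (s.1 : ℝ))) := by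
      have hsum : (m : ℝ) = s.1 + s.2 := by exact_mod_cast (mem_antidiagonal.1 hs).symm
      by_cases h1 : s.1 = 0
      · simp [h1]
      by_cases h2 : s.2 = 0
      · simp [h2]
      have h1' : (s.1 : ℝ) ≠ 0 := by exact_mod_cast h1
      have h2' : (s.2 : ℝ) ≠ 0 := by exact_mod_cast h2
      rw [if_neg h1, if_neg h2]
      field_simp
      rw [hsum]
    rw [sum_congr rfl key, sum_add_distrib, ← mul_sum, ← mul_sum,
      sum_antidiagonal_ne_zero_left fun k => 1 / (k : ℝ),
      sum_antidiagonal_swap_eq fun p q => (if q = 0 then (0 : ℝ) else 1) * (1 / (p : ℝ)),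
      sum_antidiagonal_ne_zero_left fun k => 1 / (k : ℝ), harmonicSum]
    ring
  have hsq : ∀ m, ∑ k ∈ range m, 2 * (1 / (k : ℝ) * harmonicSum k)
      + ∑ k ∈ range m, 1 / (k : ℝ) ^ 2 = harmonicSum m ^ 2 := by
    intro m
    induction m with
    | zero => simp [harmonicSum]
    | succ m ih =>
      rw [sum_range_succ, sum_range_succ, harmonicSum_succ, ← one_div_pow]
      linear_combination ih
  have hprod : ∑ p ∈ range M, ∑ q ∈ range M, 1 / (p : ℝ) * (1 / q) = harmonicSum M ^ 2 := by
    rw [harmonicSum, sq, sum_mul_sum]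
  simp only [hdiag] at h
  linear_combination h - hsq M + hprod

theorem tendsto_coeff_sum_cornerKernelThree_add (N : ℕ) :
    Tendsto (fun M => coeff (N + 1) (∑ s ∈ corner M, cornerKernelThree s.1 s.2
      + C (∑ k ∈ range M, 1 / (k : ℝ) ^ 2) * (C (1 / 2) * psumInv 2 M))) atTop (𝓝 0) := by
  have h := tendsto_sum_corner (f := fun M p q => coeff (N + 1) (cornerKernelThree p q
        + C (1 / p * (1 / q) : ℝ) * (C (1 / 2) * psumInv 2 M)))
    (fun M p q => by rw [cornerKernelThree_comm, mul_comm (1 / (p : ℝ))])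
    fun M p q hp hpq hq => abs_coeff_cornerKernelThree_add_le hp hpq hq N
  refine h.congr fun M => ?_
  rw [← map_sum, sum_add_distrib, ← sum_mul, ← map_sum, sum_corner_one_div_mul]

/-! ### Truncated multiple zeta values and their limits -/

/-- The multiple zeta value truncated to `m₁ < M`, as an iterated sum. -/
noncomputable def truncatedZeta : (n : ℕ) → (Fin n → ℕ) → ℕ → ℝ
  | 0, _, _ => 1
  | n + 1, l, M => ∑ k ∈ range M, 1 / (k : ℝ) ^ l 0 * truncatedZeta n (Fin.tail l) k

theorem strictAnti_cons {n k : ℕ} {t : Fin n → ℕ} :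
    StrictAnti (Fin.cons k t : Fin (n + 1) → ℕ) ↔ (∀ i, t i < k) ∧ StrictAnti t := by
  constructor
  · intro h
    refine ⟨fun i => by simpa using h (Fin.succ_pos i), fun i j hij => ?_⟩
    simpa using h (Fin.succ_lt_succ_iff.2 hij)
  · rintro ⟨h1, h2⟩ i j hij
    induction j using Fin.cases with
    | zero => exact absurd hij (Fin.not_lt_zero i)
    | succ j =>
      induction i using Fin.cases with
      | zero => simpa using h1 j
      | succ i => simpa using h2 (Fin.succ_lt_succ_iff.1 hij)

/-- The strictly decreasing tuples of positive integers less than `M`. -/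
noncomputable def decreasingTuples (n M : ℕ) : Finset (Fin n → ℕ) := by
  classical exact {m ∈ Fintype.piFinset fun _ => range M | StrictAnti m ∧ ∀ i, 0 < m i}

theorem mem_decreasingTuples {n M : ℕ} {m : Fin n → ℕ} :
    m ∈ decreasingTuples n M ↔ (∀ i, m i < M) ∧ StrictAnti m ∧ ∀ i, 0 < m i := by
  simp [decreasingTuples]

theorem sum_decreasingTuples_succ (n M : ℕ) (f : (Fin (n + 1) → ℕ) → ℝ) :
    ∑ m ∈ decreasingTuples (n + 1) M, f m =
      ∑ k ∈ Ico 1 M, ∑ t ∈ decreasingTuples n k, f (Fin.cons k t) := by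
  rw [sum_sigma']
  refine sum_nbij' (fun m => ⟨m 0, Fin.tail m⟩) (fun s => Fin.cons s.1 s.2) ?_ ?_ ?_ ?_ ?_
  · intro m hm
    obtain ⟨h1, h2, h3⟩ := mem_decreasingTuples.1 hm
    rw [← Fin.cons_self_tail m, strictAnti_cons] at h2
    simp only [mem_sigma, mem_Ico, mem_decreasingTuples]
    exact ⟨⟨h3 0, h1 0⟩, h2.1, h2.2, fun i => h3 i.succ⟩
  · rintro ⟨k, t⟩ hs
    simp only [mem_sigma, mem_Ico, mem_decreasingTuples] at hs ⊢
    obtain ⟨⟨h1, h2⟩, h3, h4, h5⟩ := hs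
    refine ⟨fun i => ?_, strictAnti_cons.2 ⟨h3, h4⟩, fun i => ?_⟩
    · induction i using Fin.cases with
      | zero => simpa using h2
      | succ i => simpa using (h3 i).trans h2
    · induction i using Fin.cases with
      | zero => exact h1
      | succ i => simpa using h5 i
  · intro m _
    simp
  · rintro ⟨k, t⟩ _
    simp
  · intro m _
    simp

theorem truncatedZeta_eq_sum {n : ℕ} (l : Fin n → ℕ) (h1 : ∀ i, 1 ≤ l i) (M : ℕ) :
    truncatedZeta n l M = ∑ m ∈ decreasingTuples n M, 1 / ∏ i, (m i : ℝ) ^ l i := by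
  induction n generalizing M with
  | zero =>
    have : decreasingTuples 0 M = {Fin.elim0} := by
      ext m
      simp [mem_decreasingTuples, Subsingleton.elim m Fin.elim0, Subsingleton.strictAnti]
    simp [truncatedZeta, this]
  | succ n ih =>
    rw [sum_decreasingTuples_succ, truncatedZeta]
    symm
    refine sum_subset_zero_on_sdiff (fun k hk => ?_) (fun k hk => ?_) (fun k hk => ?_)
    · simp at hk ⊢
      omega
    -- The iterated sum includes `k = 0`, which contributes `0` because `l 0 ≥ 1` and `1 / 0 = 0`.
    · have : k = 0 := by simp at hk; omega
      have h0 := h1 0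
      simp [this, show l 0 ≠ 0 by omega]
    · rw [ih (Fin.tail l) (fun i => h1 i.succ), mul_sum]
      refine sum_congr rfl fun t _ => ?_
      rw [Fin.prod_univ_succ, one_div_mul_one_div]
      simp [Fin.tail]

theorem tendsto_truncatedZeta {n : ℕ} [NeZero n] (l : Fin n → ℕ) (h2 : 2 ≤ l 0)
    (h1 : ∀ i, 1 ≤ l i) : Tendsto (truncatedZeta n l) atTop (𝓝 (multipleZeta l)) := by
  classical
  let S : ℕ → Finset (DecreasingTuple n) := fun M =>
    (Fintype.piFinset fun _ : Fin n => range M).subtype _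
  have hS : Tendsto S atTop atTop := by
    refine tendsto_atTop_finset_of_monotone (fun a b hab m hm => ?_) fun m => ?_
    · simp only [S, mem_subtype, Fintype.mem_piFinset, mem_range] at hm ⊢
      exact fun i => (hm i).trans_le hab
    · refine ⟨∑ i, m.1 i + 1, ?_⟩
      simp only [S, mem_subtype, Fintype.mem_piFinset, mem_range]
      exact fun i => Nat.lt_succ_of_le (single_le_sum (fun _ _ => Nat.zero_le _) (mem_univ i))
  have h := (summable_multipleZeta l h2 h1).hasSum.comp hS
  refine h.congr fun M => ?_
  rw [truncatedZeta_eq_sum l h1]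
  simp only [Function.comp, S]
  rw [sum_subtype_eq_sum_filter (f := fun m : Fin n → ℕ => 1 / ∏ i, (m i : ℝ) ^ l i)]
  refine sum_congr ?_ fun _ _ => rfl
  ext m
  simp [mem_decreasingTuples]

theorem tendsto_sum_one_div_pow {s : ℕ} (hs : 2 ≤ s) :
    Tendsto (fun M => ∑ k ∈ range M, 1 / (k : ℝ) ^ s) atTop (𝓝 (multipleZeta ![s])) := by
  refine (tendsto_truncatedZeta ![s] (by simpa using hs) (by simp; omega)).congr fun M => ?_
  simp [truncatedZeta]

/-! ### Coefficients as sums over multi-indices -/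

theorem sum_antidiagonalTuple_succ {R : Type*} [AddCommMonoid R] (n N : ℕ)
    (f : (Fin (n + 1) → ℕ) → R) :
    ∑ i ∈ Finset.Nat.antidiagonalTuple (n + 1) N, f i =
      ∑ s ∈ antidiagonal N, ∑ t ∈ Finset.Nat.antidiagonalTuple n s.2, f (Fin.cons s.1 t) := by
  rw [sum_sigma']
  refine sum_nbij' (fun i => ⟨(i 0, ∑ j, Fin.tail i j), Fin.tail i⟩)
    (fun s => Fin.cons s.1.1 s.2) ?_ ?_ ?_ ?_ ?_
  · intro i hi
    rw [Finset.Nat.mem_antidiagonalTuple, Fin.sum_univ_succ] at hi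
    simp only [mem_sigma, HasAntidiagonal.mem_antidiagonal, Finset.Nat.mem_antidiagonalTuple]
    exact ⟨hi, trivial⟩
  · rintro ⟨⟨u, r⟩, t⟩ hs
    simp only [mem_sigma, HasAntidiagonal.mem_antidiagonal, Finset.Nat.mem_antidiagonalTuple] at hs ⊢
    rw [Fin.sum_univ_succ]
    simp [hs.2, hs.1]
  · intro i _
    simp
  · rintro ⟨⟨u, r⟩, t⟩ hs
    simp only [mem_sigma, HasAntidiagonal.mem_antidiagonal, Finset.Nat.mem_antidiagonalTuple] at hs
    simp [hs.2]
  · intro i _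
    simp

theorem coeff_esymmInv (n N M : ℕ) :
    coeff N (esymmInv n M) =
      ∑ i ∈ Finset.Nat.antidiagonalTuple n N, truncatedZeta n (fun j => i j + 1) M := by
  induction n generalizing N M with
  | zero =>
    rw [esymmInv_zero, coeff_one]
    cases N <;> simp [truncatedZeta]
  | succ n ih =>
    rw [esymmInv_succ, map_sum, sum_antidiagonalTuple_succ]
    simp only [coeff_mul, truncatedZeta, Fin.cons_zero]
    rw [sum_comm]
    refine sum_congr rfl fun s _ => ?_
    rw [sum_comm]
    refine sum_congr rfl fun k _ => ?_
    rw [ih, coeff_invSubX, mul_sum]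
    refine sum_congr rfl fun t _ => ?_
    congr 2

/-- Weighted sums over multi-indices, grouped by the first entry. -/
theorem sum_admissibleIndices_eq (n N M : ℕ) {w : ℕ → ℝ} (hw : w 0 = 0) :
    ∑ k ∈ admissibleIndices (n + 1) (N + n + 1), w (k 0 - 1) * truncatedZeta (n + 1) k M =
      ∑ s ∈ antidiagonal N, w s.1 *
        ∑ m ∈ range M, 1 / (m : ℝ) ^ (s.1 + 1) * coeff s.2 (esymmInv n m) := by
  have h : ∑ k ∈ admissibleIndices (n + 1) (N + n + 1),
      w (k 0 - 1) * truncatedZeta (n + 1) k M =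
      ∑ i ∈ Finset.Nat.antidiagonalTuple (n + 1) N,
        w (i 0) * truncatedZeta (n + 1) (fun j => i j + 1) M := by
    -- After shifting all exponents by one, `w 0 = 0` discards exactly the indices with `l₁ = 1`.
    have hz : ∑ i ∈ Finset.Nat.antidiagonalTuple (n + 1) N with ¬ 1 ≤ i 0,
        w (i 0) * truncatedZeta (n + 1) (fun j => i j + 1) M = 0 := by
      refine sum_eq_zero fun i hi => ?_
      have : i 0 = 0 := by
        have := (mem_filter.1 hi).2
        omega
      rw [this, hw, zero_mul]
    rw [← sum_filter_add_sum_filter_not (Finset.Nat.antidiagonalTuple (n + 1) N)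
      (fun i => 1 ≤ i 0), hz, add_zero]
    refine sum_nbij' (fun k j => k j - 1) (fun i j => i j + 1) ?_ ?_ ?_ ?_ ?_
    · intro k hk
      obtain ⟨h1, h2, h3⟩ := mem_admissibleIndices.1 hk
      simp only [mem_filter, Finset.Nat.mem_antidiagonalTuple]
      refine ⟨?_, by omega⟩
      have : ∑ j, k j = ∑ j, ((k j - 1) + 1) :=
        sum_congr rfl fun j _ => (Nat.sub_add_cancel (h3 j)).symm
      rw [sum_add_distrib] at this
      simp at this
      omega
    · intro i hi
      simp only [mem_filter, Finset.Nat.mem_antidiagonalTuple] at hi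
      rw [mem_admissibleIndices, sum_add_distrib, hi.1]
      refine ⟨by simp; ring, by omega, fun j => by omega⟩
    · intro k hk
      obtain ⟨h1, h2, h3⟩ := mem_admissibleIndices.1 hk
      funext j
      exact Nat.sub_add_cancel (h3 j)
    · intro i _
      rfl
    · intro k hk
      obtain ⟨h1, h2, h3⟩ := mem_admissibleIndices.1 hk
      congr 2
      funext j
      exact (Nat.sub_add_cancel (h3 j)).symm
  rw [h, sum_antidiagonalTuple_succ]
  refine sum_congr rfl fun s _ => ?_
  simp only [Fin.cons_zero, ← mul_sum, truncatedZeta, coeff_esymmInv]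
  rw [sum_comm]
  simp only [mul_sum]
  rfl

/-- The coefficients of `m / (m - 2 X) - 1`. -/
def twoPowPos (u : ℕ) : ℝ := if u = 0 then 0 else 2 ^ u

theorem coeff_invSubTwoX_sub_C (u m : ℕ) :
    coeff u (invSubTwoX m - C (1 / (m : ℝ))) = twoPowPos u * (1 / (m : ℝ) ^ (u + 1)) := by
  rw [map_sub, coeff_invSubTwoX, coeff_C, twoPowPos]
  split_ifs with h
  · simp [h]
  · ring

theorem coeff_sum_invSubTwoX_sub_C_mul (N M : ℕ) (g : ℕ → ℝ⟦X⟧) :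
    coeff N (∑ m ∈ range M, (invSubTwoX m - C (1 / (m : ℝ))) * g m) =
      ∑ s ∈ antidiagonal N, twoPowPos s.1 *
        ∑ m ∈ range M, 1 / (m : ℝ) ^ (s.1 + 1) * coeff s.2 (g m) := by
  simp only [map_sum, coeff_mul, coeff_invSubTwoX_sub_C, mul_sum]
  rw [sum_comm]
  simp only [mul_assoc]

theorem sum_admissibleIndices_four (N M : ℕ) :
    ∑ k ∈ admissibleIndices 4 (N + 4), 2 ^ (k 0 - 1) * truncatedZeta 4 k M =
      coeff N (∑ m ∈ range M, (invSubTwoX m - C (1 / (m : ℝ))) * esymmInv 3 m) := by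
  rw [coeff_sum_invSubTwoX_sub_C_mul, ← sum_admissibleIndices_eq 3 N M (w := twoPowPos) rfl]
  refine sum_congr rfl fun k hk => ?_
  have := (mem_admissibleIndices.1 hk).2.1
  rw [twoPowPos, if_neg (by omega)]

theorem sum_admissibleIndices_three (N M : ℕ) :
    ∑ k ∈ admissibleIndices 3 (N + 4), ((N + 4 : ℕ) - (k 0 : ℝ) - 2) * 2 ^ (k 0 - 1) *
        truncatedZeta 3 k M =
      coeff N (∑ m ∈ range M, (invSubTwoX m - C (1 / (m : ℝ))) * d⁄dX ℝ (esymmInv 2 m)) := by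
  have h := sum_admissibleIndices_eq 2 (N + 1) M
    (w := fun u => ((N + 1 : ℕ) - (u : ℝ)) * twoPowPos u) (by simp [twoPowPos])
  rw [coeff_sum_invSubTwoX_sub_C_mul]
  trans ∑ k ∈ admissibleIndices (2 + 1) (N + 1 + 2 + 1), ((N + 1 : ℕ) - ((k 0 - 1 : ℕ) : ℝ)) *
    twoPowPos (k 0 - 1) * truncatedZeta (2 + 1) k M
  · refine sum_congr rfl fun k hk => ?_
    have := (mem_admissibleIndices.1 hk).2.1
    rw [twoPowPos, if_neg (by omega), Nat.cast_sub (by omega)]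
    push_cast
    ring
  -- The weight `N + 1 - u` is the degree of the inner coefficient, so the degree `0` term drops out
  -- and the rest are coefficients of a derivative.
  · rw [h, Finset.Nat.sum_antidiagonal_succ']
    simp only [sub_self, zero_mul, zero_add]
    refine sum_congr rfl fun s hs => ?_
    rw [mul_sum, mul_sum]
    refine sum_congr rfl fun m _ => ?_
    have hN : (N : ℝ) = s.1 + s.2 := by exact_mod_cast (mem_antidiagonal.1 hs).symm
    rw [coeff_derivative]
    push_cast
    rw [hN]
    ring

theorem sum_admissibleIndices_two (N M : ℕ) :
    ∑ k ∈ admissibleIndices 2 (N + 4), ((N + 4 : ℕ) - (k 0 : ℝ) - 1) *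
        ((N + 4 : ℕ) - (k 0 : ℝ) - 2) * 2 ^ (k 0 - 1) * truncatedZeta 2 k M =
      coeff N (∑ m ∈ range M, (invSubTwoX m - C (1 / (m : ℝ))) *
        d⁄dX ℝ (d⁄dX ℝ (esymmInv 1 m))) := by
  have h := sum_admissibleIndices_eq 1 (N + 2) M
    (w := fun u => ((N + 2 : ℕ) - (u : ℝ)) * ((N + 1 : ℕ) - (u : ℝ)) * twoPowPos u)
    (by simp [twoPowPos])
  rw [coeff_sum_invSubTwoX_sub_C_mul]
  trans ∑ k ∈ admissibleIndices (1 + 1) (N + 2 + 1 + 1), ((N + 2 : ℕ) - ((k 0 - 1 : ℕ) : ℝ)) *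
    ((N + 1 : ℕ) - ((k 0 - 1 : ℕ) : ℝ)) * twoPowPos (k 0 - 1) * truncatedZeta (1 + 1) k M
  · refine sum_congr rfl fun k hk => ?_
    have := (mem_admissibleIndices.1 hk).2.1
    rw [twoPowPos, if_neg (by omega), Nat.cast_sub (by omega)]
    push_cast
    ring
  · rw [h, Finset.Nat.sum_antidiagonal_succ', Finset.Nat.sum_antidiagonal_succ']
    simp only [sub_self, zero_mul, zero_add, mul_zero]
    refine sum_congr rfl fun s hs => ?_
    rw [mul_sum, mul_sum]
    refine sum_congr rfl fun m _ => ?_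
    have hN : (N : ℝ) = s.1 + s.2 := by exact_mod_cast (mem_antidiagonal.1 hs).symm
    rw [coeff_derivative, coeff_derivative]
    push_cast
    rw [hN]
    ring

/-! ### Passage to the limit -/

theorem derivative_C_mul (c : ℝ) (f : ℝ⟦X⟧) : d⁄dX ℝ (C c * f) = C c * d⁄dX ℝ f := by
  rw [Derivation.leibniz, derivative_C, smul_zero, add_zero, smul_eq_mul]

theorem derivative_esymmInvOuterZero (n M : ℕ) :
    d⁄dX ℝ (esymmInvOuterZero n M) = ∑ k ∈ range M, C (1 / (k : ℝ)) * d⁄dX ℝ (esymmInv n k) := by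
  simp only [esymmInvOuterZero, map_sum, derivative_C_mul]

theorem derivative_derivative_esymmInvOuterZero (n M : ℕ) :
    d⁄dX ℝ (d⁄dX ℝ (esymmInvOuterZero n M)) =
      ∑ k ∈ range M, C (1 / (k : ℝ)) * d⁄dX ℝ (d⁄dX ℝ (esymmInv n k)) := by
  simp only [derivative_esymmInvOuterZero, map_sum, derivative_C_mul]

theorem coeff_esymmInv_one (n M : ℕ) :
    coeff n (esymmInv 1 M) = ∑ k ∈ range M, 1 / (k : ℝ) ^ (n + 1) := by
  simp [esymmInv_one_eq_sum, coeff_invSubX]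

theorem coeff_psumInv_two (n M : ℕ) :
    coeff n (psumInv 2 M) = (n + 1) * ∑ k ∈ range M, 1 / (k : ℝ) ^ (n + 2) := by
  rw [← derivative_esymmInv_one, coeff_derivative, coeff_esymmInv_one, mul_comm]

theorem coeff_psumInv_four (n M : ℕ) :
    coeff n (psumInv 4 M) =
      (n + 1) * (n + 2) * (n + 3) / 6 * ∑ k ∈ range M, 1 / (k : ℝ) ^ (n + 4) := by
  have h3 := congrArg (coeff (n + 1)) (derivative_psumInv 2 M)
  have h4 := congrArg (coeff n) (derivative_psumInv 3 M)
  have c2 : ((2 : ℕ) : ℝ⟦X⟧) = C 2 := (map_natCast C 2).symm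
  have c3 : ((3 : ℕ) : ℝ⟦X⟧) = C 3 := (map_natCast C 3).symm
  rw [coeff_derivative, c2, coeff_C_mul, coeff_psumInv_two] at h3
  rw [coeff_derivative, c3, coeff_C_mul] at h4
  push_cast at h3 h4
  linear_combination (-1 / 3 : ℝ) * h4 - ((n : ℝ) + 1) / 6 * h3

theorem tendsto_coeff_esymmInv_sub_multipleZeta (n N : ℕ) :
    Tendsto (fun M => coeff (N + 1) (esymmInv (n + 1) M - esymmInvOuterZero n M)) atTop
      (𝓝 (multipleZeta ![N + n + 2])) := by
  have h := (tendsto_coeff_esymmInv_sub n N).add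
    (tendsto_sum_one_div_pow (s := N + n + 2) (by omega))
  simpa using h

theorem sum_invSubTwoX_sub_C_mul_esymmTail (M : ℕ) :
    ∑ m ∈ range M, (invSubTwoX m - C (1 / (m : ℝ))) * esymmTail m =
      (esymmInv 4 M - esymmInvOuterZero 3 M)
        + C (1 / 2) * d⁄dX ℝ (esymmInv 3 M - esymmInvOuterZero 2 M)
        + C (1 / 8) * d⁄dX ℝ (d⁄dX ℝ (esymmInv 2 M - esymmInvOuterZero 1 M))
        + C (1 / 48) * d⁄dX ℝ (d⁄dX ℝ (d⁄dX ℝ (esymmInv 1 M)))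
        - ∑ s ∈ corner M, cornerKernelTotal s.1 s.2 := by
  have h : ∑ m ∈ range M, C (1 / (m : ℝ)) * esymmTail m = esymmInvOuterZero 3 M
      + C (1 / 2) * d⁄dX ℝ (esymmInvOuterZero 2 M)
      + C (1 / 8) * d⁄dX ℝ (d⁄dX ℝ (esymmInvOuterZero 1 M)) := by
    rw [derivative_esymmInvOuterZero, derivative_derivative_esymmInvOuterZero, esymmInvOuterZero,
      mul_sum, mul_sum, ← sum_add_distrib, ← sum_add_distrib]
    refine sum_congr rfl fun m _ => ?_
    rw [esymmTail]
    ring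
  simp only [sub_mul, sum_sub_distrib, sum_invSubTwoX_mul_esymmTail, h, map_sub]
  ring

/-- By the sum formula every symmetric function contributes the same zeta value of weight `N + 5`.
The polynomial is `1 + (N+2)/2 + (N+3)(N+2)/8 + (N+4)(N+3)(N+2)/48`, its factors coming from the
derivatives. -/
theorem tendsto_coeff_esymmTail (N : ℕ) :
    Tendsto (fun M => coeff (N + 1)
      (∑ m ∈ range M, (invSubTwoX m - C (1 / (m : ℝ))) * esymmTail m)) atTop
      (𝓝 (((N : ℝ) + 6) * ((N + 5) ^ 2 - (N + 5) + 6) / 48 * multipleZeta ![N + 5])) := by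
  have h4 := tendsto_coeff_esymmInv_sub_multipleZeta 3 N
  have h3 := (tendsto_coeff_esymmInv_sub_multipleZeta 2 (N + 1)).const_mul (1 / 2 * ((N : ℝ) + 2))
  have h2 := (tendsto_coeff_esymmInv_sub_multipleZeta 1 (N + 2)).const_mul
    (1 / 8 * ((N : ℝ) + 3) * (N + 2))
  have h1 := (tendsto_sum_one_div_pow (s := N + 5) (by omega)).const_mul
    (1 / 48 * ((N : ℝ) + 4) * (N + 3) * (N + 2))
  have h := (((h4.add h3).add h2).add h1).sub (tendsto_coeff_sum_cornerKernelTotal N)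
  refine (h.congr fun M => ?_).trans (le_of_eq ?_)
  · rw [sum_invSubTwoX_sub_C_mul_esymmTail]
    generalize esymmInv 4 M - esymmInvOuterZero 3 M = A
    generalize esymmInv 3 M - esymmInvOuterZero 2 M = B
    generalize esymmInv 2 M - esymmInvOuterZero 1 M = D
    simp only [map_sub, map_add, coeff_C_mul, coeff_derivative, coeff_esymmInv_one]
    push_cast
    ring
  · congr 1
    rw [show N + 3 + 2 = N + 5 by ring, show N + 1 + 2 + 2 = N + 5 by ring,
      show N + 2 + 1 + 2 = N + 5 by ring]
    ring

/-- The products of the depth one values in the second identity, for truncated sums. -/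
theorem coeff_sq_psumInv_two_sub (N M : ℕ) :
    coeff (N + 1) ((psumInv 2 M - C (∑ k ∈ range M, 1 / (k : ℝ) ^ 2)) ^ 2) =
      ∑ j ∈ HasAntidiagonal.antidiagonal (N + 5) with 3 ≤ j.1 ∧ 3 ≤ j.2,
        (((j.1 : ℝ) - 1) * ∑ k ∈ range M, 1 / (k : ℝ) ^ j.1) *
          (((j.2 : ℝ) - 1) * ∑ k ∈ range M, 1 / (k : ℝ) ^ j.2) := by
  have hc (i : ℕ) : coeff i (psumInv 2 M - C (∑ k ∈ range M, 1 / (k : ℝ) ^ 2)) =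
      if i = 0 then 0 else (i + 1) * ∑ k ∈ range M, 1 / (k : ℝ) ^ (i + 2) := by
    rw [map_sub, coeff_psumInv_two, coeff_C]
    split_ifs with h
    · simp [h]
    · rw [sub_zero]
  rw [sq, coeff_mul]
  simp only [hc]
  symm
  refine sum_of_injOn (fun j => (j.1 - 2, j.2 - 2)) ?_ ?_ ?_ ?_
  · intro a ha b hb hab
    simp only [coe_filter, Set.mem_ofPred_eq, Prod.mk.injEq] at ha hb hab
    ext <;> omega
  · intro a ha
    simp only [coe_filter, Set.mem_ofPred_eq, HasAntidiagonal.mem_antidiagonal, mem_coe] at ha ⊢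
    omega
  · intro a ha hna
    by_cases h1 : a.1 = 0
    · simp [h1]
    by_cases h2 : a.2 = 0
    · simp [h2]
    refine absurd ⟨(a.1 + 2, a.2 + 2), ?_, by simp⟩ hna
    simp only [coe_filter, Set.mem_ofPred_eq, HasAntidiagonal.mem_antidiagonal] at ha ⊢
    omega
  · intro a ha
    simp only [mem_filter, HasAntidiagonal.mem_antidiagonal] at ha
    obtain ⟨i, hi⟩ := Nat.exists_eq_add_of_le ha.2.1
    obtain ⟨j, hj⟩ := Nat.exists_eq_add_of_le ha.2.2
    rw [hi, hj]
    dsimp only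
    rw [if_neg (by omega), if_neg (by omega), show 3 + i - 2 = i + 1 by omega,
      show 3 + j - 2 = j + 1 by omega, show 3 + i = i + 1 + 2 by omega,
      show 3 + j = j + 1 + 2 by omega]
    push_cast
    ring

theorem tendsto_coeff_esymmInv_three (N : ℕ) :
    Tendsto (fun M => coeff (N + 1)
      (∑ m ∈ range M, (invSubTwoX m - C (1 / (m : ℝ))) * esymmInv 3 m)) atTop
      (𝓝 (((N : ℝ) + 6) * ((N + 5) ^ 2 - 7 * (N + 5) + 18) / 24 * multipleZeta ![N + 5]
        - 1 / 4 * ∑ j ∈ HasAntidiagonal.antidiagonal (N + 5) with 3 ≤ j.1 ∧ 3 ≤ j.2,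
          (((j.1 : ℝ) - 1) * multipleZeta ![j.1]) *
            (((j.2 : ℝ) - 1) * multipleZeta ![j.2]))) := by
  have h4 := tendsto_coeff_esymmInv_sub_multipleZeta 3 N
  have h1 := (tendsto_sum_one_div_pow (s := N + 5) (by omega)).const_mul
    (((N : ℝ) + 2) * (N + 3) * (N + 4) / 24)
  have hp : Tendsto (fun M => ∑ j ∈ HasAntidiagonal.antidiagonal (N + 5) with 3 ≤ j.1 ∧ 3 ≤ j.2,
        (((j.1 : ℝ) - 1) * ∑ k ∈ range M, 1 / (k : ℝ) ^ j.1) *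
          (((j.2 : ℝ) - 1) * ∑ k ∈ range M, 1 / (k : ℝ) ^ j.2)) atTop
      (𝓝 (∑ j ∈ HasAntidiagonal.antidiagonal (N + 5) with 3 ≤ j.1 ∧ 3 ≤ j.2,
        (((j.1 : ℝ) - 1) * multipleZeta ![j.1]) * (((j.2 : ℝ) - 1) * multipleZeta ![j.2]))) := by
    refine tendsto_finsetSum _ fun j hj => ?_
    have hj' := (mem_filter.1 hj).2
    exact ((tendsto_sum_one_div_pow (by omega)).const_mul _).mul
      ((tendsto_sum_one_div_pow (by omega)).const_mul _)
  have h := ((h4.add h1).sub (hp.const_mul (1 / 4))).sub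
    (tendsto_coeff_sum_cornerKernelThree_add N)
  refine (h.congr fun M => ?_).trans (le_of_eq ?_)
  -- Completing the square with the truncated `ζ(2)` removes the constant coefficient of `psumInv 2
  -- M`; the compensating constant is invisible in degree `N + 1`.
  · have hK : ∑ m ∈ range M, (invSubTwoX m - C (1 / (m : ℝ))) * esymmInv 3 m =
        (esymmInv 4 M - esymmInvOuterZero 3 M) + C (1 / 4) * psumInv 4 M
        - C (1 / 4) * (psumInv 2 M - C (∑ k ∈ range M, 1 / (k : ℝ) ^ 2)) ^ 2
        - (∑ s ∈ corner M, cornerKernelThree s.1 s.2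
          + C (∑ k ∈ range M, 1 / (k : ℝ) ^ 2) * (C (1 / 2) * psumInv 2 M))
        + C (1 / 4 * (∑ k ∈ range M, 1 / (k : ℝ) ^ 2) ^ 2) := by
      have hc : C (1 / 2 : ℝ) = 2 * C (1 / 4) := by
        rw [← map_ofNat (C (R := ℝ)) 2, ← map_mul]; norm_num
      simp only [sub_mul, sum_sub_distrib, sum_invSubTwoX_mul_esymmInv_three]
      rw [hc, map_mul, map_pow, esymmInvOuterZero]
      ring
    rw [hK, ← coeff_sq_psumInv_two_sub]
    generalize esymmInv 4 M - esymmInvOuterZero 3 M = A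
    simp only [map_sub _ (_ + _), map_sub _ (_ - _), map_add, coeff_C_mul, coeff_psumInv_four]
    rw [coeff_C, if_neg (by omega)]
    push_cast
    ring
  · congr 1
    rw [show N + 3 + 2 = N + 5 by ring]
    ring

theorem tendsto_sum_mul_truncatedZeta (n l : ℕ) [NeZero n] (w : (Fin n → ℕ) → ℝ) :
    Tendsto (fun M => ∑ k ∈ admissibleIndices n l, w k * truncatedZeta n k M) atTop
      (𝓝 (∑ k ∈ admissibleIndices n l, w k * multipleZeta k)) := by
  refine tendsto_finsetSum _ fun k hk => ?_
  obtain ⟨_, h2, h1⟩ := mem_admissibleIndices.1 hk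
  exact (tendsto_truncatedZeta k h2 h1).const_mul _

theorem mainTheorem5 (l : ℕ) (hl : 5 ≤ l) :
    (((l : ℝ) + 1) * ((l : ℝ) ^ 2 - l + 6) / 48 * multipleZeta ![l] =
      ∑ k ∈ admissibleIndices 4 l, 2 ^ (k 0 - 1) * multipleZeta k
      + 1 / 2 * ∑ k ∈ admissibleIndices 3 l,
          ((l : ℝ) - k 0 - 2) * 2 ^ (k 0 - 1) * multipleZeta k
      + 1 / 8 * ∑ k ∈ admissibleIndices 2 l,
          ((l : ℝ) - k 0 - 1) * ((l : ℝ) - k 0 - 2) * 2 ^ (k 0 - 1) * multipleZeta k) ∧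
    (((l : ℝ) + 1) * ((l : ℝ) ^ 2 - 7 * l + 18) / 24 * multipleZeta ![l] =
      ∑ k ∈ admissibleIndices 4 l, 2 ^ (k 0 - 1) * multipleZeta k
      + 1 / 4 * ∑ j ∈ Finset.HasAntidiagonal.antidiagonal l with 3 ≤ j.1 ∧ 3 ≤ j.2,
          (((j.1 : ℝ) - 1) * multipleZeta ![j.1]) *
            (((j.2 : ℝ) - 1) * multipleZeta ![j.2])) := by
  -- Weight `N + 5` in depth four is degree `N + 1`, so `l ≥ 5` says precisely that the degree is
  -- positive.
  obtain ⟨N, rfl⟩ := Nat.exists_eq_add_of_le' hl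
  have h4 := tendsto_sum_mul_truncatedZeta 4 (N + 5) fun k => 2 ^ (k 0 - 1)
  have h3 := tendsto_sum_mul_truncatedZeta 3 (N + 5) fun k =>
    (((N + 5 : ℕ) : ℝ) - k 0 - 2) * 2 ^ (k 0 - 1)
  have h2 := tendsto_sum_mul_truncatedZeta 2 (N + 5) fun k =>
    (((N + 5 : ℕ) : ℝ) - k 0 - 1) * (((N + 5 : ℕ) : ℝ) - k 0 - 2) * 2 ^ (k 0 - 1)
  constructor
  · have h := (h4.add (h3.const_mul (1 / 2))).add (h2.const_mul (1 / 8))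
    rw [← tendsto_nhds_unique (tendsto_coeff_esymmTail N) (h.congr fun M => ?_)]
    · push_cast
      ring
    · rw [sum_admissibleIndices_four (N + 1), sum_admissibleIndices_three (N + 1),
        sum_admissibleIndices_two (N + 1), ← coeff_C_mul, ← coeff_C_mul, ← map_add, ← map_add,
        mul_sum, mul_sum, ← sum_add_distrib, ← sum_add_distrib]
      congr 1
      refine sum_congr rfl fun m _ => ?_
      rw [esymmTail]
      ring
  · rw [← tendsto_nhds_unique (tendsto_coeff_esymmInv_three N)
      (h4.congr fun M => sum_admissibleIndices_four (N + 1) M)]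
    push_cast
    ring
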